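/- Let $d\ge 1$, let $\mathcal E=\{\pm e_1,\dots,\pm e_d\}$ be the set of unit coordinate vectors of $\mathbb Z^d$ and let $\mathcal M_{\mathcal E}$ be the set of probability vectors indexed by $\mathcal E$. A cookie environment is an element $\omega=(\omega(z,e,i))_{z\in\mathbb Z^d,\,e\in\mathcal E,\,i\in\mathbb N}$, $\mathbb N=\{1,2,\dots\}$, of $\Omega=\mathcal M_{\mathcal E}^{\mathbb Z^d\times\mathbb N}$, equipped with the product Borel $\sigma$-algebra, where $(\omega(z,e,i))_{e\in\mathcal E}\in\mathcal M_{\mathcal E}$ for all $z,i$. For $\omega\in\Omega$ and $x\in\mathbb Z^d$ let $P_{x,\omega}$ be the law of the excited random walk $(X_n)_{n\ge0}$ in $\mathbb Z^d$ started at $x$ in the environment $\omega$, that is, $P_{x,\omega}[X_0=x]=1$ and $$P_{x,\omega}[X_{n+1}=X_n+e\mid X_0,\dots,X_n]=\omega\bigl(X_n,e,\#\{0\le i\le n: X_i=X_n\}\bigr)\qquad(n\ge 0,\ e\in\mathcal E).$$ For a probability measure $\mathbb P$ on $\Omega$, with expectation $\mathbb E$, let $P_0[\,\cdot\,]=\mathbb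 E\bigl[P_{0,\omega}[\,\cdot\,]\bigr]$ be the averaged law of the walk started at $0$. For $\ell\in\mathbb R^d$ let $A_\ell=\{\lim_{n\to\infty}X_n\cdot\ell=+\infty\}$. **Theorem (Kalikow-type zero-one law).** Assume that * (IID) the cookie stacks $(\omega(z,\cdot,\cdot))_{z\in\mathbb Z^d}$ are independent and identically distributed under $\mathbb P$; * (EL) for all $z\in\mathbb Z^d$, $e\in\mathcal E$ and $i\in\mathbb N$, $\mathbb P$-almost surely $\omega(z,e,i)>0$; and let $\ell\in\mathbb R^d\setminus\{0\}$. Then $$P_0\bigl[|X_n\cdot\ell|\to\infty\bigr]=P_0[A_\ell\cup A_{-\ell}]\in\{0,1\}.$$ -/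

import Mathlib

open MeasureTheory ProbabilityTheory Filter

namespace ExcitedRW

/-- The lattice `ℤ^d`. -/
abbrev Site (d : ℕ) : Type := Fin d → ℤ

/-- The finite set `𝓔 = {± e_j : j}` of unit coordinate vectors of `ℤ^d`. -/
def unitVectors (d : ℕ) : Finset (Site d) :=
  Finset.univ.image (fun j => Pi.single j 1) ∪ Finset.univ.image (fun j => -Pi.single j 1)

/-- The set `𝓔` of unit coordinate vectors, as a type. -/
abbrev Dir (d : ℕ) : Type := {e : Site d // e ∈ unitVectors d}

/-- Cookies: probability vectors indexed by `𝓔`, with the trace of the Borel `σ`-algebra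
of `ℝ^𝓔`. -/
abbrev Cookie (d : ℕ) : Type := stdSimplex ℝ (Dir d)

/-- Cookie environments, with the product `σ`-algebra. Stacks are enumerated from `0`: the
probability vector `ω z k` is the cookie consumed at the `(k + 1)`-st visit to `z`, and `(ω z k).1 e`
is the probability it gives to the direction `e`. -/
abbrev Env (d : ℕ) : Type := Site d → ℕ → Cookie d

/-- Trajectories `(X_n)_{n ≥ 0}` in `ℤ^d`, with the product `σ`-algebra. -/
abbrev Path (d : ℕ) : Type := ℕ → Site d

/-- Trajectories up to time `n`. -/
abbrev History (d n : ℕ) : Type := (i : Finset.Iic n) → Site d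

/-- The current position `X_n` for a trajectory up to time `n`. -/
def History.current {d n : ℕ} (h : History d n) : Site d := h ⟨n, Finset.mem_Iic.2 le_rfl⟩

/-- The number `#{i < n : X_i = X_n}` of earlier visits to the current position. -/
def History.earlierVisits {d n : ℕ} (h : History d n) : ℕ :=
  (Finset.univ.filter (fun i : Finset.Iic n => i.1 < n ∧ h i = h.current)).card

/-- The law of the next position: from `X_n` the walker jumps to `X_n + e` with the probability
prescribed for `e` by the first cookie left at `X_n`. -/
noncomputable def stepMeasure {d n : ℕ} (ω : Env d) (h : History d n) : Measure (Site d) :=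
  ∑ e : Dir d, ENNReal.ofReal ((ω h.current h.earlierVisits).1 e) •
    Measure.dirac (h.current + e.1)

instance {d n : ℕ} (ω : Env d) (h : History d n) : IsProbabilityMeasure (stepMeasure ω h) := by
  refine ⟨?_⟩
  have hc := (ω h.current h.earlierVisits).2
  simp only [stepMeasure, Measure.coe_finsetSum, Finset.sum_apply, Measure.smul_apply,
    measure_univ, smul_eq_mul, mul_one]
  rw [← ENNReal.ofReal_sum_of_nonneg (fun e _ => hc.1 e), hc.2, ENNReal.ofReal_one]

/-- The transition kernels of the walk in the environment `ω`. -/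
noncomputable def stepKernel {d : ℕ} (ω : Env d) (n : ℕ) : Kernel (History d n) (Site d) :=
  Kernel.ofFunOfCountable (stepMeasure ω)

instance {d : ℕ} (ω : Env d) (n : ℕ) : IsMarkovKernel (stepKernel ω n) :=
  ⟨fun h => inferInstanceAs (IsProbabilityMeasure (stepMeasure ω h))⟩

/-- The quenched law `P_{x,ω}` of the excited random walk started at `x` in the environment `ω`,
as a probability measure on trajectories. -/
noncomputable def quenchedLaw {d : ℕ} (x : Site d) (ω : Env d) : Measure (Path d) :=
  Kernel.traj (X := fun _ => Site d) (stepKernel ω) 0 (fun _ => x)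

instance {d : ℕ} (x : Site d) (ω : Env d) : IsProbabilityMeasure (quenchedLaw x ω) := by
  unfold quenchedLaw
  infer_instance

/-- A jump in the direction `e` has the probability prescribed by the current cookie. -/
lemma stepMeasure_singleton {d n : ℕ} (ω : Env d) (h : History d n) (e : Dir d) :
    stepMeasure ω h {h.current + e.1} =
      ENNReal.ofReal ((ω h.current h.earlierVisits).1 e) := by
  simp only [stepMeasure, Measure.coe_finsetSum, Finset.sum_apply, Measure.smul_apply,
    smul_eq_mul]
  rw [Finset.sum_eq_single e]
  · simp
  · intro b _ hb
    have : b.1 ≠ e.1 := fun h => hb (Subtype.ext h)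
    simp [this]
  · simp

/-- Under `P_{x,ω}` the walk starts at `x`. -/
lemma quenchedLaw_start {d : ℕ} (x : Site d) (ω : Env d) :
    quenchedLaw x ω {X | X 0 = x} = 1 := by
  have hm := Kernel.traj_map_frestrictLe_apply (X := fun _ => Site d) (κ := stepKernel ω) 0 0
    (fun _ => x)
  have h1 : quenchedLaw x ω {X | X 0 = x} =
      ((quenchedLaw x ω).map (Preorder.frestrictLe 0)) {h : History d 0 | h.current = x} := by
    rw [Measure.map_apply (by fun_prop) (Set.to_countable _).measurableSet]
    rfl
  rw [h1, quenchedLaw, hm, Kernel.partialTraj_self, Kernel.id_apply,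
    Measure.dirac_apply' _ (Set.to_countable _).measurableSet]
  simp [History.current]

/-- The transition mechanism: given the trajectory up to time `n`, the next position has the law
`stepMeasure`. -/
lemma quenchedLaw_step {d : ℕ} (x : Site d) (ω : Env d) (n : ℕ) (y : Path d) :
    quenchedLaw x ω {X | ∀ i ≤ n + 1, X i = y i} =
      quenchedLaw x ω {X | ∀ i ≤ n, X i = y i} *
        stepMeasure ω (Preorder.frestrictLe n y : History d n) {y (n + 1)} := by
  have hc : quenchedLaw x ω {X | ∀ i ≤ n, X i = y i} =
      Kernel.partialTraj (X := fun _ => Site d) (κ := stepKernel ω) 0 n (fun _ => x)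
        {Preorder.frestrictLe n y} := by
    rw [← Kernel.traj_map_frestrictLe_apply, Measure.map_apply (by fun_prop)
      (measurableSet_singleton _)]
    congr 1
    ext X
    simp [funext_iff, Preorder.frestrictLe]
  have hs : quenchedLaw x ω {X | ∀ i ≤ n + 1, X i = y i} =
      ((quenchedLaw x ω).map (fun X => (Preorder.frestrictLe n X, X (n + 1))))
        ({(Preorder.frestrictLe n y : History d n)} ×ˢ {y (n + 1)}) := by
    rw [Measure.map_apply (by fun_prop) ((measurableSet_singleton _).prod
      (measurableSet_singleton _))]
    congr 1
    ext X
    simp only [Set.mem_ofPred_eq, Set.mem_preimage, Set.mem_prod, Set.mem_singleton_iff,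
      funext_iff, Preorder.frestrictLe, Finset.restrict, Subtype.forall, Finset.mem_Iic]
    constructor
    · exact fun h => ⟨fun i hi => h i (by omega), h _ le_rfl⟩
    · rintro ⟨h, h'⟩ i hi
      rcases Nat.lt_or_ge n i with hlt | hle
      · obtain rfl : i = n + 1 := by omega
        exact h'
      · exact h i hle
  rw [hc, hs, quenchedLaw, ← Kernel.partialTraj_compProd_eq_map_traj (Nat.zero_le n),
    Measure.compProd_apply_prod (measurableSet_singleton _) (measurableSet_singleton _),
    lintegral_singleton, mul_comm]
  rfl

/-- The weight of a fixed jump depends measurably on the environment. -/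
lemma measurable_stepMeasure {d n : ℕ} (h : History d n) (z : Site d) :
    Measurable (fun ω : Env d => stepMeasure ω h {z}) := by
  simp only [stepMeasure, Measure.coe_finsetSum, Finset.sum_apply, Measure.smul_apply,
    smul_eq_mul]
  refine Finset.measurable_sum _ fun e _ => ?_
  have h1 : Measurable (fun ω : Env d => ω h.current h.earlierVisits) :=
    (measurable_pi_apply _).comp (measurable_pi_apply _)
  exact ((measurable_pi_apply e).comp
    (measurable_subtype_coe.comp h1)).ennreal_ofReal.mul_const _

/-- The quenched law depends measurably on the environment. -/
lemma measurable_quenchedLaw {d : ℕ} (x : Site d) : Measurable (quenchedLaw (d := d) x) := by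
  have hcyl : ∀ (y : Path d) (n : ℕ),
      Measurable (fun ω : Env d => quenchedLaw x ω {X | ∀ i ≤ n, X i = y i}) := by
    intro y n
    induction n with
    | zero =>
      have h0 : ∀ ω : Env d, quenchedLaw x ω {X | ∀ i ≤ 0, X i = y i} =
          if x = y 0 then 1 else 0 := by
        intro ω
        have hs := quenchedLaw_start x ω
        have hmeas : MeasurableSet {X : Path d | X 0 = x} :=
          (measurable_pi_apply (0 : ℕ) : Measurable fun X : Path d => X 0)
            (measurableSet_singleton x)
        split_ifs with hx
        · simpa [← hx] using hs
        · refine measure_mono_null ?_ ((prob_compl_eq_zero_iff hmeas).2 hs)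
          intro X hX hX'
          exact hx (hX'.symm.trans (hX 0 le_rfl))
      simp only [h0]
      exact measurable_const
    | succ n ih =>
      simp only [quenchedLaw_step]
      exact ih.mul (measurable_stepMeasure _ _)
  refine Measurable.measure_of_isPiSystem_of_isProbabilityMeasure
    generateFrom_measurableCylinders.symm isPiSystem_measurableCylinders ?_
  intro t ht
  obtain ⟨N, S, mS, rfl⟩ : ∃ N S, MeasurableSet S ∧ t = cylinder (Finset.Iic N) S := by
    simpa [measurableCylinders_nat] using ht
  have hpre : ∀ ω : Env d, quenchedLaw x ω (cylinder (Finset.Iic N) S) =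
      ∑' h : S, quenchedLaw x ω {X | ∀ i ≤ N, X i =
        (if hi : i ≤ N then h.1 ⟨i, Finset.mem_Iic.2 hi⟩ else 0)} := by
    intro ω
    have hsing : ∀ h : S, quenchedLaw x ω {X | ∀ i ≤ N, X i =
        (if hi : i ≤ N then h.1 ⟨i, Finset.mem_Iic.2 hi⟩ else 0)} =
        ((quenchedLaw x ω).map (Preorder.frestrictLe N)) {h.1} := by
      intro h
      rw [Measure.map_apply (by fun_prop) (measurableSet_singleton _)]
      congr 1
      ext X
      simp only [Set.mem_ofPred_eq, Set.mem_preimage, Set.mem_singleton_iff,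
        funext_iff, Preorder.frestrictLe, Finset.restrict, Subtype.forall, Finset.mem_Iic]
      refine forall₂_congr fun i hi => ?_
      simp [hi]
    simp only [hsing]
    have hS := measure_biUnion (μ := (quenchedLaw x ω).map (Preorder.frestrictLe N))
      (s := S) (f := fun h => {h}) (Set.to_countable S)
      (fun a _ b _ hab => by simpa using hab) (fun h _ => measurableSet_singleton h)
    rw [← hS, Set.biUnion_of_singleton, Measure.map_apply (by fun_prop) mS]
    rfl
  simp only [hpre]
  exact Measurable.tsum fun h => hcyl _ N

/-- The quenched laws as a Markov kernel from environments to trajectories. -/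
noncomputable def quenchedKernel {d : ℕ} (x : Site d) : Kernel (Env d) (Path d) where
  toFun := quenchedLaw x
  measurable' := measurable_quenchedLaw x

instance {d : ℕ} (x : Site d) : IsMarkovKernel (quenchedKernel x) :=
  ⟨fun ω => inferInstanceAs (IsProbabilityMeasure (quenchedLaw x ω))⟩

/-- The averaged (annealed) law `P_x[·] = 𝔼[P_{x,ω}[·]]` on environments and trajectories, when the
environment has law `μ`. -/
noncomputable def annealedLaw {d : ℕ} (μ : Measure (Env d)) (x : Site d) :
    Measure (Env d × Path d) :=
  μ ⊗ₘ quenchedKernel x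

/-- (IID): the cookie stacks `(ω(z,·,·))_{z ∈ ℤ^d}` are independent and identically distributed. -/
def IsIID {d : ℕ} (μ : Measure (Env d)) : Prop :=
  iIndepFun (fun (z : Site d) (ω : Env d) => ω z) μ ∧
    ∀ z z' : Site d, IdentDistrib (fun ω : Env d => ω z) (fun ω : Env d => ω z') μ μ

/-- (EL), ellipticity: for all `z`, `e` and `i`, almost surely `ω(z,e,i) > 0`. -/
def IsElliptic {d : ℕ} (μ : Measure (Env d)) : Prop :=
  ∀ (z : Site d) (e : Dir d) (i : ℕ), ∀ᵐ ω ∂μ, 0 < (ω z i).1 e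

/-- The scalar product `x · ℓ` of a lattice point with a vector of `ℝ^d`. -/
def dot {d : ℕ} (x : Site d) (ℓ : Fin d → ℝ) : ℝ := ∑ j, (x j : ℝ) * ℓ j

/-- The event `A_ℓ = {lim_n X_n · ℓ = ∞}`. -/
def transientEvent {d : ℕ} (ℓ : Fin d → ℝ) : Set (Env d × Path d) :=
  {p | Tendsto (fun n => dot (p.2 n) ℓ) atTop atTop}

/-- The event `{|X_n · ℓ| → ∞}`. -/
def absTransientEvent {d : ℕ} (ℓ : Fin d → ℝ) : Set (Env d × Path d) :=
  {p | Tendsto (fun n => |dot (p.2 n) ℓ|) atTop atTop}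

end ExcitedRW

open ExcitedRW

namespace ExcitedRW

/-! Draw all jumps in advance: each site carries a stack of arrows, and the walk is a deterministic
function of the field of stacks. Under the averaged law the stacks are i.i.d. over the sites,
although the arrows within one stack are dependent. Ellipticity gives finite energy: overwriting
finitely many arrows cannot turn an event of positive probability into a null one
(`stacksLaw_overwrite`).

Suppose that the walk escapes in direction `ℓ` with positive probability. Prepending finitely many
arrows shows that it also does so without going below its starting level (`escaping_above_ne_zero`).
At each strict record in direction `ℓ` the stacks in the half-space ahead are untouched, so the
conditional probability of escaping is bounded below; by Lévy's zero-one law the walk a.s. escapes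
once its levels are unbounded above (`ae_mem_of_not_bddAbove`).

It remains to treat walks bounded above. The same record argument, applied to finite range, shows
that the range is a.s. infinite: otherwise unbounded walks would have finite range. Since each fresh
site offers a uniformly positive chance of an upward step, a walk bounded above visits only finitely
many distinct sites above any level (`ae_finite_of_bddAbove`). If it did not escape in direction
`-ℓ`, some sites would be visited infinitely often, and those of maximal level would be finitely
many. Mass transport bounds the set of recurrent sites leading to such a top
(`ae_finite_isTopAmong`), and the walk would end up confined to this finite set, contradicting
infinite range (`escaping_neg_of_finite`). Hence the walk escapes a.s. in one of the two directions
(`ae_escaping`). -/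

/-- Fields of stacks of arrows: `ξ z i` is the jump made after the `(i + 1)`-st visit to `z`. -/
abbrev Stacks (d : ℕ) : Type := Site d → ℕ → Dir d

/-- The number of visits of the path `X` to `z` before time `n`. -/
def visits {d : ℕ} (X : Path d) (z : Site d) (n : ℕ) : ℕ := Nat.count (fun i => X i = z) n

/-- The position of the walk directed by the arrows `ξ`, with the number of arrows consumed at
each site. -/
def walkState {d : ℕ} (x : Site d) (ξ : Stacks d) : ℕ → Site d × (Site d → ℕ)
  | 0 => (x, 0)
  | n + 1 =>
    let p := walkState x ξ n
    (p.1 + (ξ p.1 (p.2 p.1)).1, fun z => p.2 z + if p.1 = z then 1 else 0)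

/-- The walk started at `x` directed by the arrows `ξ`. -/
def walk {d : ℕ} (x : Site d) (ξ : Stacks d) : Path d := fun n => (walkState x ξ n).1

/-! ### Walks directed by arrows -/

section Walk

variable {d : ℕ}

@[simp] lemma visits_zero (X : Path d) (z : Site d) : visits X z 0 = 0 := Nat.count_zero _

lemma visits_succ (X : Path d) (z : Site d) (n : ℕ) :
    visits X z (n + 1) = visits X z n + if X n = z then 1 else 0 := Nat.count_succ _ _

lemma visits_add (X : Path d) (z : Site d) (m n : ℕ) :
    visits X z (m + n) = visits X z m + visits (fun k => X (m + k)) z n := Nat.count_add _ _ _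

lemma visits_mono (X : Path d) (z : Site d) : Monotone (visits X z) := Nat.count_monotone _

lemma visits_congr {X Y : Path d} {n : ℕ} (h : ∀ i < n, X i = Y i) (z : Site d) :
    visits X z n = visits Y z n := by
  induction n with
  | zero => simp
  | succ n ih =>
    rw [visits_succ, visits_succ, ih fun i hi => h i (by omega), h n (by omega)]

lemma visits_eq_zero {X : Path d} {z : Site d} {n : ℕ} (h : ∀ i < n, X i ≠ z) :
    visits X z n = 0 := by
  induction n with
  | zero => simp
  | succ n ih => rw [visits_succ, ih fun i hi => h i (by omega), if_neg (h n (by omega))]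

lemma visits_lt {X : Path d} {z : Site d} {m n : ℕ} (hmn : m < n) (h : X m = z) :
    visits X z m < visits X z n := by
  have := visits_mono X z (Nat.succ_le_of_lt hmn)
  rw [Nat.succ_eq_add_one, visits_succ, if_pos h] at this
  omega

lemma visits_translate (X : Path d) (z a : Site d) (n : ℕ) :
    visits (fun k => X k + a) (z + a) n = visits X z n := by
  induction n with
  | zero => simp
  | succ n ih => rw [visits_succ, visits_succ, ih]; simp

@[simp] lemma walk_zero (x : Site d) (ξ : Stacks d) : walk x ξ 0 = x := rfl

lemma walkState_snd (x : Site d) (ξ : Stacks d) (n : ℕ) (z : Site d) :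
    (walkState x ξ n).2 z = visits (walk x ξ) z n := by
  induction n with
  | zero => simp [walkState]
  | succ n ih => rw [visits_succ, ← ih]; rfl

lemma walk_succ (x : Site d) (ξ : Stacks d) (n : ℕ) :
    walk x ξ (n + 1) =
      walk x ξ n + (ξ (walk x ξ n) (visits (walk x ξ) (walk x ξ n) n)).1 := by
  rw [← walkState_snd]; rfl

/-- Two walks coincide as long as the arrows consumed by the first one coincide. -/
lemma walk_congr {x : Site d} {ξ : Stacks d} {Y : Path d} {n : ℕ} (h0 : Y 0 = x)
    (h : ∀ j < n, Y (j + 1) = Y j + (ξ (Y j) (visits Y (Y j) j)).1) :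
    ∀ i ≤ n, walk x ξ i = Y i := by
  intro i
  induction i using Nat.strong_induction_on with
  | _ i ih =>
    intro hi
    cases i with
    | zero => simp [h0]
    | succ i =>
      rw [walk_succ, h i (by omega), visits_congr (Y := Y) fun j hj => ih j (by omega) (by omega),
        ih i (by omega) (by omega)]

lemma walk_eq {x : Site d} {ξ : Stacks d} {Y : Path d} (h0 : Y 0 = x)
    (h : ∀ j, Y (j + 1) = Y j + (ξ (Y j) (visits Y (Y j) j)).1) : walk x ξ = Y :=
  funext fun n => walk_congr (n := n) h0 (fun j _ => h j) n le_rfl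

lemma measurable_walk (x : Site d) : Measurable (walk x : Stacks d → Path d) := by
  have h : ∀ n, Measurable fun ξ : Stacks d => walkState x ξ n := by
    intro n
    induction n with
    | zero => exact measurable_const
    | succ n ih =>
      have h1 := ih.fst
      have h2 := ih.snd
      have h3 : Measurable fun ξ : Stacks d => (walkState x ξ n).2 (walkState x ξ n).1 :=
        (measurable_from_prod_countable_right (f := fun q : Site d × (Site d → ℕ) => q.2 q.1)
          fun z => measurable_pi_apply z).comp ih
      have h4 : Measurable fun ξ : Stacks d =>
          ξ (walkState x ξ n).1 ((walkState x ξ n).2 (walkState x ξ n).1) :=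
        (measurable_from_prod_countable_right
          (f := fun q : (Site d × ℕ) × Stacks d => q.2 q.1.1 q.1.2)
          fun z => (measurable_pi_apply z.2).comp (measurable_pi_apply z.1)).comp
          ((h1.prodMk h3).prodMk measurable_id)
      refine (h1.add h4.subtype_val).prodMk (measurable_pi_iff.2 fun z => ?_)
      refine ((measurable_pi_apply z).comp h2).add
        (Measurable.ite (h1 (measurableSet_singleton z)) measurable_const measurable_const)
  exact measurable_pi_iff.2 fun n => (h n).fst

lemma measurableSet_cylinder_path (y : Path d) (n : ℕ) :
    MeasurableSet {X : Path d | ∀ i ≤ n, X i = y i} := by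
  have : {X : Path d | ∀ i ≤ n, X i = y i} = ⋂ i ≤ n, (fun X => X i) ⁻¹' {y i} := by
    ext; simp
  rw [this]
  exact .iInter fun i => .iInter fun _ => (measurable_pi_apply i) (measurableSet_singleton _)

lemma measurableSet_follow (x : Site d) (y : Path d) (n : ℕ) :
    MeasurableSet {ξ : Stacks d | ∀ i ≤ n, walk x ξ i = y i} :=
  measurable_walk x (measurableSet_cylinder_path y n)

end Walk

/-! ### Independence and measurability for infinite products -/

section ProductMeasure

variable {ι : Type*} {X : ι → Type*} [∀ i, MeasurableSpace (X i)]

/-- Events depending on disjoint sets of coordinates are independent under a product measure. -/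
lemma infinitePi_inter (m : (i : ι) → Measure (X i)) [∀ i, IsProbabilityMeasure (m i)]
    {A B : Set ((i : ι) → X i)} (hA : MeasurableSet A) (hB : MeasurableSet B) (S : Set ι)
    (hAS : ∀ x y, (∀ i ∈ S, x i = y i) → x ∈ A → y ∈ A)
    (hBS : ∀ x y, (∀ i ∉ S, x i = y i) → x ∈ B → y ∈ B) :
    Measure.infinitePi m (A ∩ B) = Measure.infinitePi m A * Measure.infinitePi m B := by
  classical
  have hne : ∀ i, Nonempty (X i) := fun i => nonempty_of_isProbabilityMeasure (m i)
  let x₀ : (i : ι) → X i := fun i => (hne i).some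
  have key : ∀ (S : Set ι) (A : Set ((i : ι) → X i)), MeasurableSet A →
      (∀ x y, (∀ i ∈ S, x i = y i) → x ∈ A → y ∈ A) →
      MeasurableSet[⨆ i ∈ S, MeasurableSpace.comap (fun x : (i : ι) → X i => x i) inferInstance]
        A := by
    intro S A hA hAS
    -- Freezing the coordinates outside `S` at `x₀` does not affect membership in `A`, so `A` is the
    -- preimage of itself under a map that is measurable for the coordinates in `S`.
    let r : ((i : ι) → X i) → (i : ι) → X i := fun x i => if i ∈ S then x i else x₀ i
    have hr : Measurable[⨆ i ∈ S,
        MeasurableSpace.comap (fun x : (i : ι) → X i => x i) inferInstance] r := by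
      refine @measurable_pi_lambda _ _ _ (_) _ _ fun i => ?_
      by_cases hi : i ∈ S
      · simp only [r, if_pos hi]
        exact Measurable.mono (comap_measurable _) (le_iSup₂_of_le i hi le_rfl) le_rfl
      · simp only [r, if_neg hi]
        exact @measurable_const _ _ _ (_) _
    have : A = r ⁻¹' A := by
      ext x
      exact ⟨hAS x (r x) fun i hi => by simp [r, hi], hAS (r x) x fun i hi => by simp [r, hi]⟩
    rw [this]
    exact hr hA
  have hind : iIndep (fun i => MeasurableSpace.comap (fun x : (i : ι) → X i => x i) inferInstance)
      (Measure.infinitePi m) :=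
    iIndepFun_infinitePi (P := m) (X := fun _ x => x) fun _ => measurable_id
  have := indep_iSup_of_disjoint (fun i => (measurable_pi_apply i).comap_le) hind
    (disjoint_compl_right (a := S))
  exact (Indep_iff _ _ _).1 this A B (key S A hA hAS) (key Sᶜ B hB hBS)

lemma measurable_infinitePi {α : Type*} [MeasurableSpace α] (m : α → (i : ι) → Measure (X i))
    [∀ a i, IsProbabilityMeasure (m a i)] (h : ∀ i, Measurable fun a => m a i) :
    Measurable fun a => Measure.infinitePi (m a) := by
  refine Measurable.measure_of_isPiSystem_of_isProbabilityMeasure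
    generateFrom_squareCylinders.symm
    (isPiSystem_squareCylinders (fun _ => MeasurableSpace.isPiSystem_measurableSet) (by simp)) ?_
  rintro _ ⟨s, t, ht, rfl⟩
  have ht' : ∀ i, MeasurableSet (t i) := fun i => ht i (Set.mem_univ i)
  simp only [Measure.infinitePi_pi _ fun i _ => ht' i]
  exact Finset.measurable_prod _ fun i _ => (Measure.measurable_coe (ht' i)).comp (h i)

end ProductMeasure

/-! ### Arrow representation of the quenched law -/

section Quenched

variable {d : ℕ}

/-- The law of an arrow drawn from a cookie. -/
noncomputable def cookieMeasure (c : Cookie d) : Measure (Dir d) :=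
  ∑ e : Dir d, ENNReal.ofReal (c.1 e) • Measure.dirac e

instance (c : Cookie d) : IsProbabilityMeasure (cookieMeasure c) := by
  refine ⟨?_⟩
  simp only [cookieMeasure, Measure.coe_finsetSum, Finset.sum_apply, Measure.smul_apply,
    measure_univ, smul_eq_mul, mul_one]
  rw [← ENNReal.ofReal_sum_of_nonneg (fun e _ => c.2.1 e), c.2.2, ENNReal.ofReal_one]

lemma cookieMeasure_singleton (c : Cookie d) (e : Dir d) :
    cookieMeasure c {e} = ENNReal.ofReal (c.1 e) := by
  simp only [cookieMeasure, Measure.coe_finsetSum, Finset.sum_apply, Measure.smul_apply,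
    smul_eq_mul]
  rw [Finset.sum_eq_single e]
  · simp
  · intro b _ hb
    simp [hb]
  · simp

lemma measurable_cookieMeasure : Measurable (cookieMeasure (d := d)) := by
  refine Measure.measurable_of_measurable_coe _ fun s _ => ?_
  simp only [cookieMeasure, Measure.coe_finsetSum, Finset.sum_apply, Measure.smul_apply,
    smul_eq_mul]
  exact Finset.measurable_sum _ fun e _ =>
    ((measurable_pi_apply e).comp measurable_subtype_coe).ennreal_ofReal.mul_const _

/-- The law of the stack of arrows drawn from a stack of cookies. -/
noncomputable def stackMeasure (c : ℕ → Cookie d) : Measure (ℕ → Dir d) :=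
  Measure.infinitePi fun i => cookieMeasure (c i)

instance (c : ℕ → Cookie d) : IsProbabilityMeasure (stackMeasure c) := by
  unfold stackMeasure; infer_instance

lemma measurable_stackMeasure : Measurable (stackMeasure (d := d)) := by
  unfold stackMeasure
  exact measurable_infinitePi _ fun i => measurable_cookieMeasure.comp (measurable_pi_apply i)

/-- The law of the field of arrows in the environment `ω`. -/
noncomputable def quenchedStacks (ω : Env d) : Measure (Stacks d) :=
  Measure.infinitePi fun z => stackMeasure (ω z)

instance (ω : Env d) : IsProbabilityMeasure (quenchedStacks ω) := by
  unfold quenchedStacks; infer_instance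

/-- In a fixed environment all arrows are independent, within a stack as well as between stacks;
uncurrying the indices displays their law as a single product. -/
lemma quenchedStacks_inter_arrow (ω : Env d) (z : Site d) (i : ℕ) (a : Dir d) {A : Set (Stacks d)}
    (hA : MeasurableSet A)
    (hAS : ∀ ξ ξ' : Stacks d, (∀ w j, (w, j) ≠ (z, i) → ξ w j = ξ' w j) → ξ ∈ A → ξ' ∈ A) :
    quenchedStacks ω (A ∩ {ξ | ξ z i = a}) =
      quenchedStacks ω A * ENNReal.ofReal ((ω z i).1 a) := by
  have hc : quenchedStacks ω = (Measure.infinitePi fun p : Site d × ℕ =>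
      cookieMeasure (ω p.1 p.2)).map (MeasurableEquiv.curry (Site d) ℕ (Dir d)) :=
    (Measure.infinitePi_map_curry fun z i => cookieMeasure (ω z i)).symm
  have hB : MeasurableSet {ξ : Site d × ℕ → Dir d | ξ (z, i) = a} :=
    (measurable_pi_apply (z, i) : Measurable fun ξ : Site d × ℕ → Dir d => ξ (z, i))
      (measurableSet_singleton a)
  rw [hc, MeasurableEquiv.map_apply, MeasurableEquiv.map_apply, Set.preimage_inter]
  have h := infinitePi_inter (fun p : Site d × ℕ => cookieMeasure (ω p.1 p.2))
    ((MeasurableEquiv.curry (Site d) ℕ (Dir d)).measurable hA) hB {(z, i)}ᶜ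
    (fun x y hxy hx => hAS _ _ (fun w j hwj => hxy (w, j) hwj) hx)
    (fun x y hxy hx => by
      have := hxy (z, i) (by simp)
      simp only [Set.mem_ofPred_eq] at hx ⊢
      rw [← this, hx])
  refine h.trans ?_
  congr 1
  rw [← cookieMeasure_singleton,
    ← Measure.infinitePi_map_eval (fun p : Site d × ℕ => cookieMeasure (ω p.1 p.2)) (z, i),
    Measure.map_apply (by fun_prop) (measurableSet_singleton a)]
  rfl

lemma earlierVisits_frestrictLe (y : Path d) (n : ℕ) :
    History.earlierVisits (d := d) (n := n) (Preorder.frestrictLe n y) = visits y (y n) n := by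
  rw [visits, Nat.count_eq_card_filter_range, History.earlierVisits]
  refine Finset.card_bij (fun i _ => i.1) ?_ (fun a _ b _ => Subtype.ext) ?_
  · intro i hi
    have h := (Finset.mem_filter.1 hi).2
    exact Finset.mem_filter.2 ⟨Finset.mem_range.2 h.1, h.2⟩
  · intro i hi
    have hi : i < n ∧ y i = y n := by simpa using hi
    exact ⟨⟨i, Finset.mem_Iic.2 hi.1.le⟩,
      Finset.mem_filter.2 ⟨Finset.mem_univ _, hi⟩, rfl⟩

/-- The walk directed by random arrows follows a given path with the same probability as the
excited random walk. -/
lemma quenchedStacks_follow (x : Site d) (ω : Env d) (y : Path d) (n : ℕ) :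
    quenchedStacks ω {ξ | ∀ i ≤ n, walk x ξ i = y i} =
      quenchedLaw x ω {X | ∀ i ≤ n, X i = y i} := by
  induction n with
  | zero =>
    by_cases hx : x = y 0
    · have h1 := quenchedLaw_start x ω
      simp only [Nat.le_zero, forall_eq, walk_zero, hx, Set.ofPred_true, measure_univ]
      rw [hx] at h1
      exact h1.symm
    · have h1 := quenchedLaw_start x ω
      have hmeas : MeasurableSet {X : Path d | X 0 = x} :=
        (measurable_pi_apply (0 : ℕ) : Measurable fun X : Path d => X 0)
          (measurableSet_singleton x)
      have h2 : quenchedLaw x ω {X | X 0 = y 0} = 0 := by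
        refine measure_mono_null ?_ ((prob_compl_eq_zero_iff hmeas).2 h1)
        intro X hX hX'
        exact hx (hX'.symm.trans hX)
      simp [hx, h2]
  | succ n ih =>
    rw [quenchedLaw_step, ← ih]
    have hcur : History.current (d := d) (n := n) (Preorder.frestrictLe n y) = y n := rfl
    by_cases he : y (n + 1) - y n ∈ unitVectors d
    · have hy : y (n + 1) =
          History.current (d := d) (n := n) (Preorder.frestrictLe n y) +
            (⟨y (n + 1) - y n, he⟩ : Dir d).1 := by
        rw [hcur]; simp
      rw [hy, stepMeasure_singleton, earlierVisits_frestrictLe, hcur,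
        ← quenchedStacks_inter_arrow ω (y n) _ _ (measurableSet_follow x y n)]
      · congr 1
        ext ξ
        simp only [Set.mem_inter_iff, Set.mem_ofPred_eq]
        constructor
        · intro h
          refine ⟨fun i hi => h i (by omega), Subtype.ext ?_⟩
          have h1 := h (n + 1) le_rfl
          rw [walk_succ, h n (by omega), visits_congr (Y := y) fun i hi => h i (by omega)] at h1
          simp [← h1]
        · rintro ⟨h, h'⟩ i hi
          rcases Nat.lt_or_ge n i with hlt | hle
          · obtain rfl : i = n + 1 := by omega
            rw [walk_succ, h n le_rfl, visits_congr (Y := y) fun i hi => h i (by omega), h']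
            simp
          · exact h i hle
      -- The first `n` steps do not use the arrow consumed at time `n`: earlier visits to `y n`
      -- consumed arrows of strictly smaller index.
      · intro ξ ξ' hξ h
        have h' : ∀ i ≤ n, walk x ξ i = y i := h
        intro i hi
        rw [← h' i hi]
        refine walk_congr (Y := walk x ξ) rfl (fun j hj => ?_) i hi
        rw [walk_succ, hξ]
        intro hEq
        have h1 := congrArg Prod.fst hEq
        have h2 := congrArg Prod.snd hEq
        simp only at h1 h2
        rw [h1, visits_congr (Y := y) fun i hi => h' i (by omega)] at h2
        exact absurd h2 (visits_lt hj (by rw [← h1, h' j hj.le])).ne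
    -- A jump that is not a unit vector has probability zero on both sides.
    · have h1 : stepMeasure ω (Preorder.frestrictLe n y : History d n) {y (n + 1)} = 0 := by
        simp only [stepMeasure, Measure.coe_finsetSum, Finset.sum_apply, Measure.smul_apply,
          smul_eq_mul]
        refine Finset.sum_eq_zero fun e _ => ?_
        rw [Measure.dirac_apply' _ (measurableSet_singleton _), Set.indicator_of_notMem, mul_zero]
        intro h
        apply he
        rw [← Set.mem_singleton_iff.1 h, hcur]
        simp
      rw [h1, mul_zero]
      convert measure_empty (μ := quenchedStacks ω)
      ext ξ
      simp only [Set.mem_ofPred_eq, Set.mem_empty_iff_false, iff_false]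
      intro h
      apply he
      rw [← h (n + 1) le_rfl, ← h n (by omega), walk_succ]
      simp

/-- Laws of paths are determined by the probabilities of following given finite paths. -/
lemma path_measure_ext {P Q : Measure (Path d)} [IsProbabilityMeasure P] [IsProbabilityMeasure Q]
    (h : ∀ (y : Path d) (n : ℕ), P {X | ∀ i ≤ n, X i = y i} = Q {X | ∀ i ≤ n, X i = y i}) :
    P = Q := by
  refine ext_of_generate_finite _ generateFrom_measurableCylinders.symm
    isPiSystem_measurableCylinders ?_ (by simp)
  intro t ht
  obtain ⟨N, S, mS, rfl⟩ : ∃ N S, MeasurableSet S ∧ t = cylinder (Finset.Iic N) S := by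
    simpa [measurableCylinders_nat] using ht
  have hm : P.map (Preorder.frestrictLe (π := fun _ : ℕ => Site d) N) =
      Q.map (Preorder.frestrictLe (π := fun _ : ℕ => Site d) N) := by
    refine Measure.ext_of_singleton fun a => ?_
    rw [Measure.map_apply (by fun_prop) (measurableSet_singleton _),
      Measure.map_apply (by fun_prop) (measurableSet_singleton _)]
    have : Preorder.frestrictLe (π := fun _ : ℕ => Site d) N ⁻¹' {a} = {X : Path d | ∀ i ≤ N, X i =
        (fun i => if hi : i ≤ N then a ⟨i, Finset.mem_Iic.2 hi⟩ else 0) i} := by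
      ext X
      simp only [Set.mem_ofPred_eq, Set.mem_preimage, Set.mem_singleton_iff,
        funext_iff, Preorder.frestrictLe, Finset.restrict, Subtype.forall, Finset.mem_Iic]
      refine forall₂_congr fun i hi => ?_
      simp [hi]
    rw [this]
    exact h _ N
  have := congrArg (fun R => R S) hm
  simp only [Measure.map_apply (by fun_prop : Measurable
    (Preorder.frestrictLe (π := fun _ : ℕ => Site d) N)) mS] at this
  exact this

lemma quenchedLaw_eq_map (x : Site d) (ω : Env d) :
    quenchedLaw x ω = (quenchedStacks ω).map (walk x) := by
  have : IsProbabilityMeasure ((quenchedStacks ω).map (walk x)) :=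
    Measure.isProbabilityMeasure_map (measurable_walk x).aemeasurable
  refine path_measure_ext fun y n => ?_
  rw [← quenchedStacks_follow, Measure.map_apply (measurable_walk x)]
  · rfl
  · exact measurableSet_cylinder_path y n

end Quenched

/-! ### Averaged law of the arrows: independence, finite energy, translation invariance -/

section Averaged

variable {d : ℕ}

/-- The averaged law of one stack of arrows. -/
noncomputable def arrowLaw (μ : Measure (Env d)) : Measure (ℕ → Dir d) :=
  (μ.map fun ω => ω 0).bind stackMeasure

/-- The law of a field of independent stacks of arrows with the averaged law. -/
noncomputable def stacksLaw (μ : Measure (Env d)) : Measure (Stacks d) :=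
  Measure.infinitePi fun _ : Site d => arrowLaw μ

instance (μ : Measure (Env d)) [IsProbabilityMeasure μ] : IsProbabilityMeasure (arrowLaw μ) := by
  have : IsProbabilityMeasure (μ.map fun ω => ω 0) :=
    Measure.isProbabilityMeasure_map (measurable_pi_apply _).aemeasurable
  refine ⟨?_⟩
  rw [arrowLaw, Measure.bind_apply .univ measurable_stackMeasure.aemeasurable]
  simp

instance (μ : Measure (Env d)) [IsProbabilityMeasure μ] : IsProbabilityMeasure (stacksLaw μ) := by
  unfold stacksLaw; infer_instance

lemma measurable_quenchedStacks : Measurable (quenchedStacks (d := d)) := by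
  unfold quenchedStacks
  exact measurable_infinitePi _ fun z => measurable_stackMeasure.comp (measurable_pi_apply z)

/-- Given the environment the stacks are independent, and the law of each depends only on the
cookies at its site; averaging over i.i.d. cookie stacks therefore factorises on cylinder sets. -/
lemma stacksLaw_eq_bind {μ : Measure (Env d)} [IsProbabilityMeasure μ] (hIID : IsIID μ) :
    stacksLaw μ = μ.bind quenchedStacks := by
  refine (Measure.eq_infinitePi _ fun s t ht => ?_).symm
  have hs : MeasurableSet ((s : Set (Site d)).pi t) :=
    .pi (Finset.countable_toSet s) fun i _ => ht i
  rw [Measure.bind_apply hs measurable_quenchedStacks.aemeasurable]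
  have h1 : ∀ ω : Env d, quenchedStacks ω ((s : Set (Site d)).pi t) =
      ∏ z ∈ s, stackMeasure (ω z) (t z) := fun ω => Measure.infinitePi_pi _ fun i _ => ht i
  have hm : ∀ z, Measurable fun c : ℕ → Cookie d => stackMeasure c (t z) := fun z =>
    (Measure.measurable_coe (ht z)).comp measurable_stackMeasure
  simp only [h1]
  rw [lintegral_prod_eq_prod_lintegral_of_indepFun s
    (fun z (ω : Env d) => stackMeasure (ω z) (t z))
    (hIID.1.comp (fun z c => stackMeasure c (t z)) hm)
    fun z => (hm z).comp (measurable_pi_apply z)]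
  refine Finset.prod_congr rfl fun z _ => ?_
  rw [arrowLaw, Measure.bind_apply (ht z) measurable_stackMeasure.aemeasurable,
    ← (hIID.2 z 0).map_eq, lintegral_map (hm z) (measurable_pi_apply z)]

/-- The averaged law of the walk is the law of the walk directed by independent stacks. -/
lemma annealedLaw_snd {μ : Measure (Env d)} [IsProbabilityMeasure μ] (hIID : IsIID μ)
    (x : Site d) {Q : Set (Path d)} (hQ : MeasurableSet Q) :
    annealedLaw μ x {p | p.2 ∈ Q} = stacksLaw μ {ξ | walk x ξ ∈ Q} := by
  have hS : MeasurableSet {p : Env d × Path d | p.2 ∈ Q} := measurable_snd hQ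
  have hW : MeasurableSet {ξ : Stacks d | walk x ξ ∈ Q} := measurable_walk x hQ
  rw [stacksLaw_eq_bind hIID, Measure.bind_apply hW
    measurable_quenchedStacks.aemeasurable, annealedLaw,
    Measure.compProd_apply hS]
  refine lintegral_congr fun ω => ?_
  change quenchedLaw x ω Q = _
  rw [quenchedLaw_eq_map, Measure.map_apply (measurable_walk x) hQ]
  rfl

/-- Replacing the arrows with labels in `J` by those of `a`. -/
def overwrite (J : Finset (Site d × ℕ)) (a ξ : Stacks d) : Stacks d :=
  fun z i => if (z, i) ∈ J then a z i else ξ z i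

lemma measurable_overwrite (J : Finset (Site d × ℕ)) (a : Stacks d) :
    Measurable (overwrite J a) := by
  refine measurable_pi_iff.2 fun z => measurable_pi_iff.2 fun i => ?_
  unfold overwrite
  split_ifs
  · exact measurable_const
  · exact (measurable_pi_apply i).comp (measurable_pi_apply z)

/-- In almost every environment the preimage of `N` does not depend on the overwritten arrow, hence
is independent of the event that this arrow already equals `a z i`. On that event overwriting
changes nothing, so the intersection lies in `N` and is null, while the arrow event has positive
probability. -/
lemma stacksLaw_overwrite_singleton {μ : Measure (Env d)} [IsProbabilityMeasure μ]
    (hIID : IsIID μ) (hEL : IsElliptic μ) (z : Site d) (i : ℕ) (a : Stacks d)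
    {N : Set (Stacks d)} (hN : MeasurableSet N) (h0 : stacksLaw μ N = 0) :
    stacksLaw μ (overwrite {(z, i)} a ⁻¹' N) = 0 := by
  have hT := measurable_overwrite {(z, i)} a
  have hm : ∀ {M : Set (Stacks d)}, MeasurableSet M →
      Measurable fun ω : Env d => quenchedStacks ω M := fun hM =>
    (Measure.measurable_coe hM).comp measurable_quenchedStacks
  rw [stacksLaw_eq_bind hIID, Measure.bind_apply hN measurable_quenchedStacks.aemeasurable,
    lintegral_eq_zero_iff (hm hN)] at h0
  rw [stacksLaw_eq_bind hIID, Measure.bind_apply (hT hN) measurable_quenchedStacks.aemeasurable,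
    lintegral_eq_zero_iff (hm (hT hN))]
  filter_upwards [h0, hEL z (a z i) i] with ω h hpos
  have h1 := quenchedStacks_inter_arrow ω z i (a z i) (hT hN) (by
    intro ξ ξ' hξ h
    have : overwrite {(z, i)} a ξ = overwrite {(z, i)} a ξ' := by
      ext w j : 2
      unfold overwrite
      split_ifs with hw
      · rfl
      · exact hξ w j (by simpa using hw)
    simpa [Set.mem_preimage, this] using h)
  have h2 : quenchedStacks ω (overwrite {(z, i)} a ⁻¹' N ∩ {ξ | ξ z i = a z i}) = 0 := by
    refine measure_mono_null ?_ h
    rintro ξ ⟨h, h'⟩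
    have : overwrite {(z, i)} a ξ = ξ := by
      ext w j : 2
      unfold overwrite
      split_ifs with hw
      · obtain ⟨rfl, rfl⟩ : w = z ∧ j = i := by simpa using hw
        exact h'.symm
      · rfl
    rwa [Set.mem_preimage, this] at h
  rw [h2] at h1
  rcases mul_eq_zero.1 h1.symm with h3 | h3
  · exact h3
  · exact absurd h3 (by simpa using hpos)

/-- Finitely many arrows may be changed at the cost of a positive factor. -/
lemma stacksLaw_overwrite {μ : Measure (Env d)} [IsProbabilityMeasure μ]
    (hIID : IsIID μ) (hEL : IsElliptic μ) (J : Finset (Site d × ℕ)) (a : Stacks d)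
    {N : Set (Stacks d)} (hN : MeasurableSet N) (h0 : stacksLaw μ N = 0) :
    stacksLaw μ (overwrite J a ⁻¹' N) = 0 := by
  classical
  induction J using Finset.induction_on generalizing N with
  | empty =>
    have : overwrite ∅ a = id := by ext ξ : 1; ext w j : 2; simp [overwrite]
    simpa [this] using h0
  | insert p J hp ih =>
    have : overwrite (insert p J) a = overwrite {p} a ∘ overwrite J a := by
      ext ξ : 1
      ext w j : 2
      by_cases h1 : (w, j) = p <;> by_cases h2 : (w, j) ∈ J <;> simp [overwrite, h1, h2]
    rw [this, Set.preimage_comp]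
    exact ih (measurable_overwrite _ _ hN)
      (stacksLaw_overwrite_singleton hIID hEL p.1 p.2 a hN h0)

lemma stacksLaw_ne_zero_of_overwrite {μ : Measure (Env d)} [IsProbabilityMeasure μ]
    (hIID : IsIID μ) (hEL : IsElliptic μ) (J : Finset (Site d × ℕ)) (a : Stacks d)
    {E E' : Set (Stacks d)} (hE' : MeasurableSet E') (h : ∀ ξ ∈ E, overwrite J a ξ ∈ E')
    (h0 : stacksLaw μ E ≠ 0) : stacksLaw μ E' ≠ 0 := fun h1 =>
  h0 (measure_mono_null (fun ξ hξ => h ξ hξ) (stacksLaw_overwrite hIID hEL J a hE' h1))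

/-- Translation of fields of stacks. -/
def shiftStacks (a : Site d) (ξ : Stacks d) : Stacks d := fun z => ξ (z + a)

lemma measurable_shiftStacks (a : Site d) : Measurable (shiftStacks a) :=
  measurable_pi_iff.2 fun z => measurable_pi_apply (z + a)

lemma stacksLaw_map_shift (μ : Measure (Env d)) [IsProbabilityMeasure μ] (a : Site d) :
    (stacksLaw μ).map (shiftStacks a) = stacksLaw μ :=
  Measure.map_infinitePi_infinitePi_of_inj (P := fun _ : Site d => arrowLaw μ)
    (add_left_injective a)

lemma stacksLaw_shift (μ : Measure (Env d)) [IsProbabilityMeasure μ] (a : Site d)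
    {E : Set (Stacks d)} (hE : MeasurableSet E) :
    stacksLaw μ (shiftStacks a ⁻¹' E) = stacksLaw μ E := by
  rw [← Measure.map_apply (measurable_shiftStacks a) hE, stacksLaw_map_shift]

lemma walk_shiftStacks (a x : Site d) (ξ : Stacks d) (n : ℕ) :
    walk (x + a) ξ n = walk x (shiftStacks a ξ) n + a := by
  refine congrFun (walk_eq (Y := fun n => walk x (shiftStacks a ξ) n + a) rfl fun j => ?_) n
  simp only [visits_translate, walk_succ, shiftStacks]
  abel

end Averaged

/-! ### Lévy's zero-one law -/

section Levy

open scoped Topology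

variable {d : ℕ}

/-- If the conditional probability of `Q` is at least `c` given any history in `G n`, then it is at
least `c` given any event of the past contained in `G n`. -/
lemma mul_le_of_forall_history {P : Measure (Path d)} {Q : Set (Path d)}
    {c : ENNReal} {n : ℕ} {A : Set (Path d)}
    (hA : MeasurableSet[Filtration.piLE (X := fun _ : ℕ => Site d) n] A)
    (h : ∀ y ∈ A, c * P {X | ∀ i ≤ n, X i = y i} ≤ P (Q ∩ {X | ∀ i ≤ n, X i = y i})) :
    c * P A ≤ P (Q ∩ A) := by
  rw [Filtration.piLE_eq_comap_frestrictLe] at hA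
  obtain ⟨B, hB, rfl⟩ := hA
  set r : Path d → History d n := Preorder.frestrictLe n with hr
  have hrm : Measurable r := by fun_prop
  have hcyl : ∀ y : Path d, r ⁻¹' {r y} = {X | ∀ i ≤ n, X i = y i} := by
    intro y
    ext X
    simp [hr, funext_iff, Preorder.frestrictLe]
  have e1 : P (r ⁻¹' B) = ∑' b, B.indicator (fun b => P.map r {b}) b := by
    rw [Measure.tsum_indicator_apply_singleton _ _ hB, Measure.map_apply hrm hB]
  have e2 : P (Q ∩ r ⁻¹' B) = ∑' b, B.indicator (fun b => (P.restrict Q).map r {b}) b := by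
    rw [Measure.tsum_indicator_apply_singleton _ _ hB, Measure.map_apply hrm hB,
      Measure.restrict_apply (hrm hB), Set.inter_comm]
  rw [e1, e2, ← ENNReal.tsum_mul_left]
  refine ENNReal.tsum_le_tsum fun b => ?_
  by_cases hb : b ∈ B
  · rw [Set.indicator_of_mem hb, Set.indicator_of_mem hb,
      Measure.map_apply hrm (measurableSet_singleton b),
      Measure.map_apply hrm (measurableSet_singleton b),
      Measure.restrict_apply (hrm (measurableSet_singleton b)), Set.inter_comm]
    let y : Path d := fun i => if hi : i ≤ n then b ⟨i, Finset.mem_Iic.2 hi⟩ else 0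
    have hy : r y = b := by
      ext i : 1
      have hi := Finset.mem_Iic.1 i.2
      simp [hr, y, Preorder.frestrictLe, hi]
    have := h y (by simpa [hy] using hb)
    rwa [← hcyl, hy] at this
  · simp [Set.indicator_of_notMem hb]

/-- A consequence of Lévy's zero-one law: if `Q` has conditional probability at least `c > 0`
given any history in `G n`, then `Q` occurs almost surely when infinitely many of the events `G n`
occur. -/
lemma ae_mem_of_frequently {P : Measure (Path d)} [IsProbabilityMeasure P] {Q : Set (Path d)}
    (hQ : MeasurableSet Q) {c : ENNReal} (hc : c ≠ 0) (G : ℕ → Set (Path d))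
    (hG : ∀ n X Y, (∀ i ≤ n, X i = Y i) → X ∈ G n → Y ∈ G n)
    (h : ∀ n, ∀ y ∈ G n, c * P {X | ∀ i ≤ n, X i = y i} ≤
      P (Q ∩ {X | ∀ i ≤ n, X i = y i})) :
    ∀ᵐ X ∂P, (∃ᶠ n in atTop, X ∈ G n) → X ∈ Q := by
  -- Only needed to make `c` finite before passing to real numbers.
  wlog hc1 : c ≤ 1 generalizing c
  · exact this one_ne_zero (fun n y hy => le_trans (by gcongr; exact (not_le.1 hc1).le) (h n y hy))
      le_rfl
  have hct : c ≠ ⊤ := ne_top_of_le_ne_top ENNReal.one_ne_top hc1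
  set ℱ := Filtration.piLE (X := fun _ : ℕ => Site d) with hℱ
  set q : Path d → ℝ := Q.indicator 1 with hq
  have hqi : Integrable q P := (integrable_const (1 : ℝ)).indicator hQ
  have hGm : ∀ n, MeasurableSet[ℱ n] (G n) := by
    intro n
    rw [hℱ, Filtration.piLE_eq_comap_frestrictLe]
    refine ⟨Preorder.frestrictLe n '' G n, (Set.to_countable _).measurableSet, ?_⟩
    ext X
    constructor
    · rintro ⟨Y, hY, hYX⟩
      refine hG n Y X (fun i hi => ?_) hY
      exact congrFun hYX ⟨i, Finset.mem_Iic.2 hi⟩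
    · exact fun hX => ⟨X, hX, rfl⟩
  have hle : ∀ n, ∀ᵐ X ∂P, X ∈ G n → c.toReal ≤ (P[q|ℱ n]) X := by
    intro n
    set f := P[q|ℱ n] with hf
    have hfm : StronglyMeasurable[ℱ n] f := stronglyMeasurable_condExp
    -- On this event of the past the conditional probability is too small, whereas its average over
    -- the event is at least `c`; hence the event is null.
    set A := G n ∩ {X | f X < c.toReal} with hA
    have hAm : MeasurableSet[ℱ n] A :=
      MeasurableSet.inter (hGm n) (measurableSet_lt hfm.measurable measurable_const)
    have hAm' : MeasurableSet A := ℱ.le n _ hAm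
    have h1 : c * P A ≤ P (Q ∩ A) := mul_le_of_forall_history hAm fun y hy => h n y hy.1
    have h2 : ∫ X in A, f X ∂P = P.real (Q ∩ A) := by
      rw [hf, setIntegral_condExp (ℱ.le n) hqi hAm, hq, integral_indicator_one hQ,
        measureReal_restrict_apply hQ]
    have h3 : ∫ X in A, (c.toReal - f X) ∂P ≤ 0 := by
      rw [integral_sub (integrable_const _).integrableOn integrable_condExp.integrableOn, h2,
        setIntegral_const, smul_eq_mul, mul_comm, sub_nonpos, measureReal_def, measureReal_def,
        ← ENNReal.toReal_mul]
      exact ENNReal.toReal_mono (measure_ne_top _ _) h1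
    have h4 : P A = 0 := by
      by_contra hne
      refine absurd h3 (not_le.2 ?_)
      rw [setIntegral_pos_iff_support_of_nonneg_ae]
      · refine (pos_iff_ne_zero.2 hne).trans_le (measure_mono fun X hX => ⟨?_, hX⟩)
        exact (sub_pos.2 hX.2).ne'
      · exact (ae_restrict_mem hAm').mono fun X hX => (sub_pos.2 hX.2).le
      · exact ((integrable_const _).sub integrable_condExp).integrableOn
    have h5 : ∀ᵐ X ∂P, X ∉ A := measure_eq_zero_iff_ae_notMem.1 h4
    filter_upwards [h5] with X hX hXG
    by_contra hlt
    exact hX ⟨hXG, not_le.1 hlt⟩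
  have hsup : ⨆ n, (ℱ n : MeasurableSpace (Path d)) = MeasurableSpace.pi := by
    refine le_antisymm (iSup_le fun n => ℱ.le n) (iSup_le fun i => ?_)
    refine le_trans ?_ (le_iSup _ i)
    rw [hℱ, Filtration.piLE_eq_comap_frestrictLe, ← measurable_iff_comap_le]
    exact (measurable_pi_apply (⟨i, Finset.mem_Iic.2 le_rfl⟩ : Finset.Iic i)).comp
      (comap_measurable (Preorder.frestrictLe (π := fun _ : ℕ => Site d) i))
  have hlim := tendsto_ae_condExp (μ := P) (ℱ := ℱ) q
  have hqm : StronglyMeasurable q := (stronglyMeasurable_const (b := (1 : ℝ))).indicator hQ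
  -- The whole past generates the full σ-algebra, so the conditional probabilities converge a.s. to
  -- the indicator of `Q`; being at least `c` infinitely often excludes the limit `0`.
  rw [hsup, condExp_of_stronglyMeasurable le_rfl hqm hqi] at hlim
  filter_upwards [hlim, ae_all_iff.2 hle] with X hX hX' hfreq
  by_contra hXQ
  have h0 : q X = 0 := Set.indicator_of_notMem hXQ _
  rw [h0] at hX
  have hev := hX.eventually (gt_mem_nhds (ENNReal.toReal_pos hc hct))
  obtain ⟨n, hn, hn'⟩ := (hfreq.and_eventually hev).exists
  exact absurd (hX' n hn) (not_le.2 hn')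

/-- The version of `ae_mem_of_frequently` for the walk directed by independent stacks. -/
lemma ae_walk_mem_of_frequently {μ : Measure (Env d)} [IsProbabilityMeasure μ]
    {Q : Set (Path d)} (hQ : MeasurableSet Q) {c : ENNReal} (hc : c ≠ 0) (G : ℕ → Set (Path d))
    (hG : ∀ n X Y, (∀ i ≤ n, X i = Y i) → X ∈ G n → Y ∈ G n)
    (h : ∀ n, ∀ y ∈ G n, c * stacksLaw μ {ξ | ∀ i ≤ n, walk 0 ξ i = y i} ≤
      stacksLaw μ ({ξ | walk 0 ξ ∈ Q} ∩ {ξ | ∀ i ≤ n, walk 0 ξ i = y i})) :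
    ∀ᵐ ξ ∂stacksLaw μ, (∃ᶠ n in atTop, walk 0 ξ ∈ G n) → walk 0 ξ ∈ Q := by
  have hw := measurable_walk (0 : Site d)
  have : IsProbabilityMeasure ((stacksLaw μ).map (walk 0)) :=
    Measure.isProbabilityMeasure_map hw.aemeasurable
  refine ae_of_ae_map hw.aemeasurable
    (ae_mem_of_frequently (P := (stacksLaw μ).map (walk 0)) hQ hc G hG fun n y hy => ?_)
  rw [Measure.map_apply hw (measurableSet_cylinder_path y n),
    Measure.map_apply hw (hQ.inter (measurableSet_cylinder_path y n))]
  exact h n y hy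

end Levy

/-! ### Records and fresh sites -/

section Records

variable {d : ℕ}

lemma dot_add (x y : Site d) (ℓ : Fin d → ℝ) : dot (x + y) ℓ = dot x ℓ + dot y ℓ := by
  simp [dot, add_mul, Finset.sum_add_distrib]

lemma dot_neg (x : Site d) (ℓ : Fin d → ℝ) : dot (-x) ℓ = -dot x ℓ := by simp [dot]

lemma dot_neg_right (x : Site d) (ℓ : Fin d → ℝ) : dot x (-ℓ) = -dot x ℓ := by simp [dot]

lemma dot_sub (x y : Site d) (ℓ : Fin d → ℝ) : dot (x - y) ℓ = dot x ℓ - dot y ℓ := by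
  rw [sub_eq_add_neg, dot_add, dot_neg, sub_eq_add_neg]

lemma exists_dir_dot_pos {ℓ : Fin d → ℝ} (hℓ : ℓ ≠ 0) : ∃ e : Dir d, 0 < dot e.1 ℓ := by
  obtain ⟨j, hj⟩ := Function.ne_iff.1 hℓ
  have h1 : dot (Pi.single j 1 : Site d) ℓ = ℓ j := by
    simp [dot, Pi.single_apply]
  rcases lt_or_gt_of_ne hj with h | h
  · exact ⟨⟨-Pi.single j 1, by simp [unitVectors]⟩, by rw [dot_neg, h1]; simpa using h⟩
  · exact ⟨⟨Pi.single j 1, by simp [unitVectors]⟩, by rw [h1]; simpa using h⟩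

/-- Once at `x`, the walk moves like a walk started at `x` as long as the latter avoids the sites
visited before. -/
lemma walk_add_of_fresh {ξ : Stacks d} {x : Site d} {n : ℕ}
    (h : ∀ i < n, ∀ k, walk (walk x ξ n) ξ k ≠ walk x ξ i) (k : ℕ) :
    walk x ξ (n + k) = walk (walk x ξ n) ξ k := by
  induction k using Nat.strong_induction_on with
  | _ k ih =>
    cases k with
    | zero => simp
    | succ k =>
      rw [← add_assoc, walk_succ, walk_succ, visits_add, ih k (by omega),
        visits_eq_zero fun i hi h' => h i hi k h'.symm, zero_add,
        visits_congr fun i hi => ih i (by omega)]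

/-- Following a finite path is independent of the stacks which have not been touched. -/
lemma stacksLaw_inter_follow {μ : Measure (Env d)} [IsProbabilityMeasure μ] (y : Path d) (n : ℕ)
    {B : Set (Stacks d)} (hB : MeasurableSet B) (S : Set (Site d)) (hS : ∀ i < n, y i ∉ S)
    (hBS : ∀ ξ ξ' : Stacks d, (∀ z ∈ S, ξ z = ξ' z) → ξ ∈ B → ξ' ∈ B) :
    stacksLaw μ (B ∩ {ξ | ∀ i ≤ n, walk 0 ξ i = y i}) =
      stacksLaw μ B * stacksLaw μ {ξ | ∀ i ≤ n, walk 0 ξ i = y i} := by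
  refine infinitePi_inter _ hB (measurableSet_follow 0 y n) S hBS fun ξ ξ' hξ h => ?_
  have h' : ∀ i ≤ n, walk 0 ξ i = y i := h
  intro i hi
  rw [← h' i hi]
  refine walk_congr (Y := walk 0 ξ) rfl (fun j hj => ?_) i hi
  rw [walk_succ, hξ]
  rw [h' j hj.le]
  exact hS j hj

lemma measurableSet_dot_walk (x : Site d) (ℓ : Fin d → ℝ) (c : ℝ) :
    MeasurableSet {ξ : Stacks d | ∀ k, c ≤ dot (walk x ξ k) ℓ} := by
  have : {ξ : Stacks d | ∀ k, c ≤ dot (walk x ξ k) ℓ} =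
      ⋂ k, (fun ξ => walk x ξ k) ⁻¹' {z | c ≤ dot z ℓ} := by ext; simp
  rw [this]
  exact .iInter fun k => ((measurable_pi_apply k).comp (measurable_walk x))
    (Set.to_countable _).measurableSet

/-- The first time at which `f` exceeds a bound for its values up to time `N` is a strict record
after `N`. -/
lemma frequently_record {f : ℕ → ℝ} (h : ¬BddAbove (Set.range f)) :
    ∃ᶠ n in atTop, ∀ i < n, f i < f n := by
  classical
  rw [frequently_atTop]
  intro N
  obtain ⟨M, hM⟩ : ∃ M, ∀ i ≤ N, f i ≤ M := by
    obtain ⟨M, hM⟩ := ((Set.finite_Iic N).image f).bddAbove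
    exact ⟨M, fun i hi => hM ⟨i, hi, rfl⟩⟩
  have hex : ∃ n, M < f n := by
    by_contra! hcon
    exact h ⟨M, by rintro _ ⟨n, rfl⟩; exact hcon n⟩
  refine ⟨Nat.find hex, ?_, fun i hi => ?_⟩
  · by_contra hlt
    exact absurd (Nat.find_spec hex) (not_lt.2 (hM _ (not_le.1 hlt).le))
  · exact (not_lt.1 (Nat.find_min hex hi)).trans_lt (Nat.find_spec hex)

/-- If `Q` occurs with positive probability for a walk which never goes below its starting
level, then `Q` occurs almost surely when the walk is unbounded in the direction `ℓ`. -/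
lemma ae_mem_of_not_bddAbove {μ : Measure (Env d)} [IsProbabilityMeasure μ] (ℓ : Fin d → ℝ)
    {Q : Set (Path d)} (hQ : MeasurableSet Q)
    (hshift : ∀ (X : Path d) (n : ℕ) (a : Site d), (fun k => X (n + k) - a) ∈ Q → X ∈ Q)
    (hpos : stacksLaw μ {ξ | walk 0 ξ ∈ Q ∧ ∀ k, 0 ≤ dot (walk 0 ξ k) ℓ} ≠ 0) :
    ∀ᵐ ξ ∂stacksLaw μ, ¬BddAbove (Set.range fun n => dot (walk 0 ξ n) ℓ) → walk 0 ξ ∈ Q := by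
  set W : Set (Stacks d) := {ξ | walk 0 ξ ∈ Q ∧ ∀ k, 0 ≤ dot (walk 0 ξ k) ℓ} with hW
  have hWm : MeasurableSet W := (measurable_walk 0 hQ).inter (measurableSet_dot_walk 0 ℓ 0)
  -- The constant is the probability of `W`, and the favourable histories are those ending at a
  -- strict record. `W` translated to `y n` depends only on the half-space above the record level,
  -- which contains no site visited earlier.
  have key := ae_walk_mem_of_frequently (μ := μ) hQ hpos
    (fun n => {X | ∀ i < n, dot (X i) ℓ < dot (X n) ℓ}) ?_ ?_
  · filter_upwards [key] with ξ hξ hb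
    exact hξ (frequently_record hb)
  · intro n X Y hXY hX i hi
    rw [← hXY i hi.le, ← hXY n le_rfl]
    exact hX i hi
  · intro n y hy
    have hwalk : ∀ ξ : Stacks d, ∀ k, walk (y n) ξ k = walk 0 (shiftStacks (y n) ξ) k + y n :=
      fun ξ k => by rw [← walk_shiftStacks, zero_add]
    have hBm := measurable_shiftStacks (y n) hWm
    have hstay : ∀ ξ ∈ shiftStacks (y n) ⁻¹' W, ∀ k, dot (y n) ℓ ≤ dot (walk (y n) ξ k) ℓ := by
      intro ξ hξ k
      have := hξ.2 k
      rw [hwalk, dot_add]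
      linarith
    rw [← stacksLaw_shift μ (y n) hWm, ← stacksLaw_inter_follow y n hBm
      {z | dot (y n) ℓ ≤ dot z ℓ} (fun i hi => not_le.2 (hy i hi))]
    · refine measure_mono ?_
      rintro ξ ⟨hξ, hf⟩
      refine ⟨?_, hf⟩
      have hf' : ∀ i ≤ n, walk 0 ξ i = y i := hf
      refine hshift _ n (y n) ?_
      have h1 : (fun k => walk 0 ξ (n + k) - y n) = walk 0 (shiftStacks (y n) ξ) := by
        ext k : 1
        rw [walk_add_of_fresh, hf' n le_rfl, hwalk, add_sub_cancel_right]
        intro i hi k hk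
        rw [hf' n le_rfl, hf' i hi.le] at hk
        have := hstay ξ hξ k
        rw [hk] at this
        exact absurd (hy i hi) (not_lt.2 this)
      rw [h1]
      exact hξ.1
    -- A walk that never leaves the half-space reads only stacks inside it.
    · intro ξ ξ' hξξ' hξ
      have h1 : walk (y n) ξ' = walk (y n) ξ := by
        refine walk_eq rfl fun j => ?_
        rw [walk_succ, hξξ' _ (hstay ξ hξ j)]
      have h2 : walk 0 (shiftStacks (y n) ξ') = walk 0 (shiftStacks (y n) ξ) := by
        ext k : 1
        have := congrFun h1 k
        rwa [hwalk, hwalk, add_left_inj] at this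
      change walk 0 (shiftStacks (y n) ξ') ∈ Q ∧ ∀ k, 0 ≤ dot (walk 0 (shiftStacks (y n) ξ') k) ℓ
      rw [h2]
      exact hξ

/-- First hitting times of distinct sites are distinct, so infinitely many sites give arbitrarily
late first visits. -/
lemma frequently_fresh {X : Path d} {S : Set (Site d)} (h : (S ∩ Set.range X).Infinite) :
    ∃ᶠ n in atTop, X n ∈ S ∧ ∀ i < n, X i ≠ X n := by
  classical
  rw [frequently_atTop]
  intro N
  obtain ⟨z, ⟨hzS, hz⟩, hzN⟩ := h.exists_notMem_finite ((Set.finite_Iio N).image X)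
  have hz' : ∃ n, X n = z := hz
  have hspec := Nat.find_spec hz'
  refine ⟨Nat.find hz', ?_, by rwa [hspec], fun i hi => ?_⟩
  · by_contra hlt
    exact hzN ⟨_, not_le.1 hlt, hspec⟩
  · rw [hspec]
    exact Nat.find_min hz' hi

lemma infinite_of_frequently_fresh {X : Path d} {p : Site d → Prop}
    (h : ∃ᶠ n in atTop, p (X n) ∧ ∀ i < n, X i ≠ X n) : {z | p z}.Infinite := by
  rw [Nat.frequently_atTop_iff_infinite] at h
  refine (h.image (f := X) ?_).mono ?_
  · intro m hm n hn hmn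
    by_contra hne
    rcases lt_or_gt_of_ne hne with hlt | hlt
    · exact hn.2 m hlt hmn
    · exact hm.2 n hlt hmn.symm
  · rintro _ ⟨n, hn, rfl⟩
    exact hn.1

lemma stacksLaw_arrow_ne_zero {μ : Measure (Env d)} [IsProbabilityMeasure μ]
    (hIID : IsIID μ) (hEL : IsElliptic μ) (z : Site d) (e : Dir d) :
    stacksLaw μ {ξ | ξ z 0 = e} ≠ 0 := by
  refine stacksLaw_ne_zero_of_overwrite hIID hEL {(z, 0)} (fun _ _ => e) (E := Set.univ) ?_ ?_ ?_
  · exact (((measurable_pi_apply 0).comp (measurable_pi_apply z) :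
      Measurable fun ξ : Stacks d => ξ z 0)) (measurableSet_singleton e)
  · intro ξ _
    simp [overwrite]
  · simp

/-- A walk visiting infinitely many sites above a level visits infinitely many sites above the
level shifted by one step. -/
lemma ae_infinite_step {μ : Measure (Env d)} [IsProbabilityMeasure μ]
    (hIID : IsIID μ) (hEL : IsElliptic μ) (ℓ : Fin d → ℝ) (e : Dir d) (u : ℝ) :
    ∀ᵐ ξ ∂stacksLaw μ, ({z | u < dot z ℓ} ∩ Set.range (walk 0 ξ)).Infinite →
      ({z | u + dot e.1 ℓ < dot z ℓ} ∩ Set.range (walk 0 ξ)).Infinite := by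
  -- After time `N` some first visit to a site above level `u` is followed by a jump `e`. At such a
  -- first visit the top arrow is still unread, and it equals `e` with a probability not depending
  -- on the site.
  let Q : ℕ → Set (Path d) := fun N => {X | ∃ m ≥ N, (∀ i < m, X i ≠ X m) ∧
    u < dot (X m) ℓ ∧ X (m + 1) = X m + e.1}
  have hQm : ∀ N, MeasurableSet (Q N) := by
    intro N
    have h1 : ∀ i j : ℕ, MeasurableSet {X : Path d | X i = X j} := fun i j =>
      measurableSet_eq_fun (measurable_pi_apply i) (measurable_pi_apply j)
    have h2 : ∀ m : ℕ, MeasurableSet {X : Path d | u < dot (X m) ℓ} := fun m =>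
      (measurable_pi_apply m : Measurable fun X : Path d => X m)
        (Set.to_countable {z : Site d | u < dot z ℓ}).measurableSet
    have h3 : ∀ m : ℕ, MeasurableSet {X : Path d | X (m + 1) = X m + e.1} := fun m =>
      measurableSet_eq_fun (measurable_pi_apply (m + 1)) ((measurable_pi_apply m).add_const _)
    have : Q N = ⋃ m ≥ N, ((⋂ i < m, {X : Path d | X i = X m}ᶜ) ∩
        ({X : Path d | u < dot (X m) ℓ} ∩ {X : Path d | X (m + 1) = X m + e.1})) := by
      ext X
      simp only [Q, Set.mem_ofPred_eq, Set.mem_iUnion, Set.mem_inter_iff, Set.mem_iInter,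
        Set.mem_compl_iff, exists_prop]
    rw [this]
    exact .iUnion fun m => .iUnion fun _ => (MeasurableSet.iInter fun i => .iInter fun _ =>
      (h1 i m).compl).inter ((h2 m).inter (h3 m))
  have key : ∀ N, ∀ᵐ ξ ∂stacksLaw μ, (∃ᶠ n in atTop, walk 0 ξ ∈
      {X : Path d | N ≤ n ∧ u < dot (X n) ℓ ∧ ∀ i < n, X i ≠ X n}) → walk 0 ξ ∈ Q N := by
    intro N
    refine ae_walk_mem_of_frequently (μ := μ) (hQm N) (stacksLaw_arrow_ne_zero hIID hEL 0 e)
      (fun n => {X : Path d | N ≤ n ∧ u < dot (X n) ℓ ∧ ∀ i < n, X i ≠ X n}) ?_ ?_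
    · rintro n X Y hXY ⟨h1, h2, h3⟩
      refine ⟨h1, by rwa [← hXY n le_rfl], fun i hi => ?_⟩
      rw [← hXY i hi.le, ← hXY n le_rfl]
      exact h3 i hi
    · rintro n y ⟨h1, h2, h3⟩
      have hm : MeasurableSet {ξ : Stacks d | ξ 0 0 = e} :=
        (((measurable_pi_apply 0).comp (measurable_pi_apply 0) :
          Measurable fun ξ : Stacks d => ξ 0 0)) (measurableSet_singleton e)
      have hpre : shiftStacks (y n) ⁻¹' {ξ : Stacks d | ξ 0 0 = e} = {ξ | ξ (y n) 0 = e} := by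
        ext ξ; simp [shiftStacks]
      rw [← stacksLaw_shift μ (y n) hm, ← stacksLaw_inter_follow y n
        (measurable_shiftStacks (y n) hm) {y n} (fun i hi => h3 i hi), hpre]
      · refine measure_mono ?_
        rintro ξ ⟨hξ, hf⟩
        refine ⟨?_, hf⟩
        have hf' : ∀ i ≤ n, walk 0 ξ i = y i := hf
        have hξ' : ξ (y n) 0 = e := hξ
        refine ⟨n, h1, fun i hi => ?_, by rwa [hf' n le_rfl], ?_⟩
        · rw [hf' i hi.le, hf' n le_rfl]
          exact h3 i hi
        · rw [walk_succ, hf' n le_rfl, visits_eq_zero, hξ']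
          intro i hi
          rw [hf' i hi.le]
          exact h3 i hi
      · intro ξ ξ' hξ h
        rw [hpre] at h ⊢
        simp only [Set.mem_ofPred_eq] at h ⊢
        rw [← hξ (y n) rfl, h]
  filter_upwards [ae_all_iff.2 key] with ξ hξ hinf
  have hfr := frequently_fresh hinf
  have hQ : ∀ N, walk 0 ξ ∈ Q N := fun N => hξ N
    ((hfr.and_eventually (eventually_ge_atTop N)).mono fun n hn => ⟨hn.2, hn.1.1, hn.1.2⟩)
  have hf2 : ∃ᶠ n in atTop, (u < dot (walk 0 ξ n) ℓ ∧ walk 0 ξ n + e.1 ∈ Set.range (walk 0 ξ)) ∧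
      ∀ i < n, walk 0 ξ i ≠ walk 0 ξ n := by
    rw [frequently_atTop]
    intro N
    obtain ⟨m, hm, h1, h2, h3⟩ := hQ N
    exact ⟨m, hm, ⟨h2, m + 1, h3⟩, h1⟩
  have hinf2 := infinite_of_frequently_fresh
    (p := fun z => u < dot z ℓ ∧ z + e.1 ∈ Set.range (walk 0 ξ)) hf2
  refine (hinf2.image (add_left_injective e.1).injOn).mono ?_
  rintro _ ⟨z, hz, rfl⟩
  refine ⟨?_, hz.2⟩
  have := hz.1
  simp only [Set.mem_ofPred_eq, dot_add]
  linarith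

/-- A walk bounded in the direction `ℓ` visits finitely many sites above any level. -/
lemma ae_finite_of_bddAbove {μ : Measure (Env d)} [IsProbabilityMeasure μ]
    (hIID : IsIID μ) (hEL : IsElliptic μ) {ℓ : Fin d → ℝ} (hℓ : ℓ ≠ 0) :
    ∀ᵐ ξ ∂stacksLaw μ, BddAbove (Set.range fun n => dot (walk 0 ξ n) ℓ) →
      ∀ u, ({z | u < dot z ℓ} ∩ Set.range (walk 0 ξ)).Finite := by
  obtain ⟨e, he⟩ := exists_dir_dot_pos hℓ
  -- Rational base levels keep the exceptional set null although the conclusion concerns every real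
  -- `u`.
  have h : ∀ᵐ ξ ∂stacksLaw μ, ∀ (q : ℚ) (k : ℕ),
      ({z | (q : ℝ) + k * dot e.1 ℓ < dot z ℓ} ∩ Set.range (walk 0 ξ)).Infinite →
      ({z | (q : ℝ) + k * dot e.1 ℓ + dot e.1 ℓ < dot z ℓ} ∩ Set.range (walk 0 ξ)).Infinite :=
    ae_all_iff.2 fun q => ae_all_iff.2 fun k => ae_infinite_step hIID hEL ℓ e _
  filter_upwards [h] with ξ hξ hb u
  by_contra hinf
  obtain ⟨M, hM⟩ := hb
  obtain ⟨q, hq⟩ := exists_rat_lt u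
  have hall : ∀ k : ℕ,
      ({z | (q : ℝ) + k * dot e.1 ℓ < dot z ℓ} ∩ Set.range (walk 0 ξ)).Infinite := by
    intro k
    induction k with
    | zero =>
      refine Set.Infinite.mono ?_ hinf
      rintro z ⟨hz, hz'⟩
      refine ⟨?_, hz'⟩
      have : u < dot z ℓ := hz
      simp only [Set.mem_ofPred_eq, Nat.cast_zero, zero_mul, add_zero]
      linarith
    | succ k ih =>
      convert hξ q k ih using 5
      push_cast
      ring
  obtain ⟨k, hk⟩ := exists_nat_gt ((M - q) / dot e.1 ℓ)
  obtain ⟨z, hz, n, rfl⟩ := (hall k).nonempty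
  have h1 : dot (walk 0 ξ n) ℓ ≤ M := hM ⟨n, rfl⟩
  have h2 : (q : ℝ) + k * dot e.1 ℓ < dot (walk 0 ξ n) ℓ := hz
  rw [div_lt_iff₀ he] at hk
  linarith

end Records

/-! ### Escape and finite range without going below the starting level -/

section HalfSpace

variable {d : ℕ}

lemma visits_le_of_forall_ne {X : Path d} {z : Site d} {N : ℕ} (h : ∀ n ≥ N, X n ≠ z) (n : ℕ) :
    visits X z n ≤ visits X z N := by
  rcases le_total n N with hn | hn
  · exact visits_mono X z hn
  · obtain ⟨k, rfl⟩ := Nat.exists_eq_add_of_le hn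
    rw [visits_add, visits_eq_zero (n := k) fun i _ => h _ (Nat.le_add_right N i), add_zero]

lemma visits_le (X : Path d) (z : Site d) (n : ℕ) : visits X z n ≤ n := Nat.count_le _

lemma exists_visits_eq {X : Path d} {z : Site d} (h : ∃ᶠ n in atTop, X n = z) (i : ℕ) :
    ∃ n, X n = z ∧ visits X z n = i := by
  rw [Nat.frequently_atTop_iff_infinite] at h
  exact ⟨Nat.nth (fun n => X n = z) i, Nat.nth_mem_of_infinite h i, Nat.count_nth_of_infinite h i⟩

lemma stacksLaw_walk_sub (μ : Measure (Env d)) [IsProbabilityMeasure μ] (x : Site d)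
    {C : Set (Path d)} (hC : MeasurableSet C) :
    stacksLaw μ {ξ | (fun k => walk x ξ k - x) ∈ C} = stacksLaw μ {ξ | walk 0 ξ ∈ C} := by
  have hW : MeasurableSet {ξ : Stacks d | walk 0 ξ ∈ C} := measurable_walk 0 hC
  rw [← stacksLaw_shift μ x hW]
  congr 1
  ext ξ
  have : (fun k => walk x ξ k - x) = walk 0 (shiftStacks x ξ) := by
    ext k : 1
    rw [sub_eq_iff_eq_add, ← walk_shiftStacks, zero_add]
  simp [this]

lemma measurableSet_inter_above {C : Set (Path d)} (hC : MeasurableSet C) (ℓ : Fin d → ℝ) :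
    MeasurableSet {X : Path d | X ∈ C ∧ ∀ j, 0 ≤ dot (X j) ℓ} := by
  have : {X : Path d | X ∈ C ∧ ∀ j, 0 ≤ dot (X j) ℓ} =
      C ∩ ⋂ j, (fun X : Path d => X j) ⁻¹' {z | 0 ≤ dot z ℓ} := by
    ext; simp
  rw [this]
  exact hC.inter
    (.iInter fun j => (measurable_pi_apply j) (Set.to_countable _).measurableSet)

/-- The set of paths escaping in the direction `ℓ`. -/
def escaping (ℓ : Fin d → ℝ) : Set (Path d) := {X | Tendsto (fun n => dot (X n) ℓ) atTop atTop}

lemma measurableSet_escaping (ℓ : Fin d → ℝ) : MeasurableSet (escaping ℓ) :=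
  measurableSet_tendsto atTop fun n => (measurable_of_countable fun z : Site d => dot z ℓ).comp
    (measurable_pi_apply n)

lemma measurableSet_escaping_above (x : Site d) (ℓ : Fin d → ℝ) (c : ℝ) :
    MeasurableSet {ξ : Stacks d | walk x ξ ∈ escaping ℓ ∧ ∀ k, c ≤ dot (walk x ξ k) ℓ} :=
  (measurable_walk x (measurableSet_escaping ℓ)).inter (measurableSet_dot_walk x ℓ c)

lemma exists_visits_le_of_escaping {X : Path d} {ℓ : Fin d → ℝ} (h : X ∈ escaping ℓ)
    (z : Site d) : ∃ M, ∀ n, visits X z n ≤ M := by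
  obtain ⟨N, hN⟩ := eventually_atTop.1 (h.eventually (eventually_gt_atTop (dot z ℓ)))
  exact ⟨_, visits_le_of_forall_ne fun n hn hz => (hN n hn).ne' (by rw [hz])⟩

/-- Inserting an arrow at `x - e`: the walk started at `x - e` first jumps to `x`, and then moves
like the original one. -/
lemma walk_overwrite_prepend {x : Site d} {e : Dir d} {ξ : Stacks d} {M : ℕ} {a : Stacks d}
    (hM : ∀ n, visits (walk x ξ) (x - e.1) n ≤ M) (h0 : a (x - e.1) 0 = e)
    (ha : ∀ i < M, a (x - e.1) (i + 1) = ξ (x - e.1) i) (k : ℕ) :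
    walk (x - e.1) (overwrite ({x - e.1} ×ˢ Finset.range (M + 1)) a ξ) (k + 1) = walk x ξ k := by
  set s := x - e.1 with hs
  -- The expected path: `s` followed by the original walk. Its extra visit to `s` at time `0` shifts
  -- the arrow indices at `s` by one and leaves those at other sites unchanged.
  let Y : Path d := fun n => Nat.casesOn n s (walk x ξ)
  have hY : ∀ z j, visits Y z (j + 1) = (if s = z then 1 else 0) + visits (walk x ξ) z j := by
    intro z j
    rw [add_comm j 1, visits_add]
    congr 1
    · rw [show 1 = 0 + 1 from rfl, visits_succ]
      simp [Y]
    · exact visits_congr (fun i _ => by rw [add_comm 1 i]) z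
  refine congrFun (walk_eq (Y := Y) rfl fun j => ?_) (k + 1)
  cases j with
  | zero =>
    change x = s + (overwrite _ a ξ s (visits Y s 0)).1
    rw [visits_zero, overwrite, if_pos (by simp), h0, hs, sub_add_cancel]
  | succ j =>
    change walk x ξ (j + 1) = walk x ξ j + (overwrite _ a ξ (walk x ξ j)
      (visits Y (walk x ξ j) (j + 1))).1
    rw [hY, walk_succ]
    congr 2
    by_cases hz : s = walk x ξ j
    · have h1 := hM (j + 1)
      rw [visits_succ, if_pos hz.symm] at h1
      rw [if_pos hz, ← hz, overwrite, if_pos, add_comm 1, ha _ (by omega)]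
      simp only [Finset.mem_product, Finset.mem_singleton, Finset.mem_range, true_and]
      omega
    · rw [if_neg hz, zero_add, overwrite, if_neg]
      simp only [Finset.mem_product, Finset.mem_singleton, not_and_or]
      exact Or.inl (Ne.symm hz)

/-- An escaping walk visits `x - e` only finitely often, so inserting an arrow `e` at the top of
that stack amounts to changing finitely many arrows. -/
lemma escaping_step {μ : Measure (Env d)} [IsProbabilityMeasure μ]
    (hIID : IsIID μ) (hEL : IsElliptic μ) (ℓ : Fin d → ℝ) (e : Dir d) (x : Site d) {c c' : ℝ}
    (hc : c' ≤ c) (hx : c' ≤ dot (x - e.1) ℓ)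
    (h : stacksLaw μ {ξ | walk x ξ ∈ escaping ℓ ∧ ∀ k, c ≤ dot (walk x ξ k) ℓ} ≠ 0) :
    stacksLaw μ {ξ | walk (x - e.1) ξ ∈ escaping ℓ ∧
      ∀ k, c' ≤ dot (walk (x - e.1) ξ k) ℓ} ≠ 0 := by
  set A := {ξ : Stacks d | walk x ξ ∈ escaping ℓ ∧ ∀ k, c ≤ dot (walk x ξ k) ℓ} with hA
  -- The shifted arrows depend on the field, whereas overwriting uses fixed ones. Splitting into
  -- countably many events according to a bound `M` on the visits to `x - e` and the first `M`
  -- arrows there makes them deterministic.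
  let E : (Σ M : ℕ, Fin M → Dir d) → Set (Stacks d) := fun q =>
    {ξ | ξ ∈ A ∧ (∀ n, visits (walk x ξ) (x - e.1) n ≤ q.1) ∧ ∀ i, ξ (x - e.1) i.1 = q.2 i}
  have hsub : A ⊆ ⋃ q, E q := by
    intro ξ hξ
    obtain ⟨M, hM⟩ := exists_visits_le_of_escaping hξ.1 (x - e.1)
    exact Set.mem_iUnion.2 ⟨⟨M, fun i => ξ (x - e.1) i⟩, hξ, hM, fun i => rfl⟩
  obtain ⟨⟨M, b⟩, hq⟩ : ∃ q, stacksLaw μ (E q) ≠ 0 := by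
    by_contra! hcon
    exact h (measure_mono_null hsub (measure_iUnion_null hcon))
  -- Arrow `e` on top, then the prescribed `M` arrows; the final `e` is a dummy value outside the
  -- overwritten labels.
  let a : Stacks d := fun _ i => Nat.casesOn i e fun i => if hi : i < M then b ⟨i, hi⟩ else e
  refine stacksLaw_ne_zero_of_overwrite hIID hEL ({x - e.1} ×ˢ Finset.range (M + 1)) a
    (measurableSet_escaping_above _ ℓ c') ?_ hq
  rintro ξ ⟨hξ, hM, hb⟩
  have hw := walk_overwrite_prepend (a := a) hM rfl fun i hi => by
    simp [a, hi, hb ⟨i, hi⟩]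
  refine ⟨?_, fun k => ?_⟩
  · change Tendsto _ atTop atTop
    rw [← tendsto_add_atTop_iff_nat 1]
    simp only [hw]
    exact hξ.1
  · cases k with
    | zero => exact hx
    | succ k =>
      rw [hw]
      exact hc.trans (hξ.2 k)

/-- If the walk escapes in the direction `ℓ` with positive probability, then it does so with
positive probability without going below its starting level. -/
lemma escaping_above_ne_zero {μ : Measure (Env d)} [IsProbabilityMeasure μ]
    (hIID : IsIID μ) (hEL : IsElliptic μ) {ℓ : Fin d → ℝ} (hℓ : ℓ ≠ 0)
    (h : stacksLaw μ {ξ | walk 0 ξ ∈ escaping ℓ} ≠ 0) :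
    stacksLaw μ {ξ | walk 0 ξ ∈ escaping ℓ ∧ ∀ k, 0 ≤ dot (walk 0 ξ k) ℓ} ≠ 0 := by
  obtain ⟨e, he⟩ := exists_dir_dot_pos hℓ
  obtain ⟨m, hm⟩ : ∃ m : ℕ, stacksLaw μ
      {ξ | walk 0 ξ ∈ escaping ℓ ∧ ∀ k, -(m : ℝ) ≤ dot (walk 0 ξ k) ℓ} ≠ 0 := by
    by_contra! hcon
    refine h (measure_mono_null (fun ξ hξ => ?_) (measure_iUnion_null hcon))
    have hξ' : Tendsto (fun n => dot (walk 0 ξ n) ℓ) atTop atTop := hξ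
    obtain ⟨M, hM⟩ := bddBelow_range_of_tendsto_atTop_atTop hξ'
    obtain ⟨m, hm⟩ := exists_nat_ge (-M)
    exact Set.mem_iUnion.2 ⟨m, hξ, fun k => (by linarith : -(m : ℝ) ≤ M).trans (hM ⟨k, rfl⟩)⟩
  -- Moving the start back by `k` steps `e` preserves the lower bound, except that the starting
  -- level itself may become the minimum.
  have hstep : ∀ k : ℕ, stacksLaw μ {ξ | walk (-(k • e.1)) ξ ∈ escaping ℓ ∧
      ∀ j, min (-(m : ℝ)) (-(k * dot e.1 ℓ)) ≤ dot (walk (-(k • e.1)) ξ j) ℓ} ≠ 0 := by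
    have hdot : ∀ k : ℕ, dot (-(k • e.1)) ℓ = -(k * dot e.1 ℓ) := by
      intro k
      rw [dot_neg]
      simp [dot, Finset.mul_sum, mul_assoc]
    intro k
    induction k with
    | zero =>
      simp only [zero_smul, neg_zero, Nat.cast_zero, zero_mul]
      rw [min_eq_left (by simp)]
      exact hm
    | succ k ih =>
      have hx : -((k + 1) • e.1) = -(k • e.1) - e.1 := by rw [succ_nsmul]; abel
      have h1 := escaping_step hIID hEL ℓ e (-(k • e.1))
        (c' := min (-(m : ℝ)) (-((k + 1 : ℕ) * dot e.1 ℓ))) ?_ ?_ ih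
      · rwa [hx]
      · refine min_le_min le_rfl ?_
        push_cast
        nlinarith
      · rw [← hx, hdot]
        exact min_le_right _ _
  -- For this `k` the starting level is at most `-m`, so it is the minimum, and translation to the
  -- origin concludes.
  obtain ⟨k, hk⟩ := exists_nat_ge (m / dot e.1 ℓ)
  rw [div_le_iff₀ he] at hk
  have h2 := stacksLaw_walk_sub μ (-(k • e.1))
    (measurableSet_inter_above (measurableSet_escaping ℓ) ℓ)
  simp only [Set.mem_ofPred_eq] at h2
  rw [← h2]
  refine fun h0 => hstep k (measure_mono_null ?_ h0)
  rintro ξ ⟨hξ, hξ'⟩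
  have hd : dot (-(k • e.1)) ℓ = -(k * dot e.1 ℓ) := by
    rw [dot_neg]
    simp [dot, Finset.mul_sum, mul_assoc]
  refine ⟨?_, fun j => ?_⟩
  · change Tendsto _ atTop atTop
    simp only [dot_sub]
    exact tendsto_atTop_add_const_right _ _ hξ
  · rw [dot_sub, hd]
    have := hξ' j
    rw [min_eq_right (by linarith)] at this
    linarith

/-- The set of paths with finite range. -/
def finiteRange (d : ℕ) : Set (Path d) := {X | (Set.range X).Finite}

lemma mem_finiteRange_iff {X : Path d} :
    X ∈ finiteRange d ↔ ∃ F : Finset (Site d), ∀ n, X n ∈ F := by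
  constructor
  · intro h
    have h' : (Set.range X).Finite := h
    exact ⟨h'.toFinset, fun n => by simp⟩
  · rintro ⟨F, hF⟩
    exact F.finite_toSet.subset (by rintro _ ⟨n, rfl⟩; exact hF n)

lemma measurableSet_finiteRange : MeasurableSet (finiteRange d) := by
  have : finiteRange d = ⋃ F : Finset (Site d), ⋂ n, (fun X : Path d => X n) ⁻¹' F := by
    ext X
    simp [mem_finiteRange_iff]
  rw [this]
  exact .iUnion fun F => .iInter fun n => (measurable_pi_apply n) F.measurableSet

/-- A path with finite range eventually stays in the set of the sites visited infinitely often. -/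
lemma exists_trap {x : Site d} {ξ : Stacks d} (h : walk x ξ ∈ finiteRange d) :
    ∃ (V : Finset (Site d)) (k : ℕ), V.Nonempty ∧ ∀ z ∈ V, ∀ i ≥ k, z + (ξ z i).1 ∈ V := by
  classical
  obtain ⟨F, hF⟩ := mem_finiteRange_iff.1 h
  set X := walk x ξ with hX
  set V := F.filter fun z => ∃ᶠ n in atTop, X n = z with hV
  have hev : ∀ᶠ n in atTop, X n ∈ V := by
    have : ∀ z ∈ F, z ∉ V → ∀ᶠ n in atTop, X n ≠ z := by
      intro z hz hzV
      rw [hV, Finset.mem_filter] at hzV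
      exact not_frequently.1 fun hf => hzV ⟨hz, hf⟩
    have h2 : ∀ᶠ n in atTop, ∀ z ∈ F, z ∉ V → X n ≠ z :=
      (eventually_all_finset F).2 fun z hz => by
        by_cases hzV : z ∈ V
        · exact .of_forall fun n h => absurd hzV h
        · exact (this z hz hzV).mono fun n hn _ => hn
    filter_upwards [h2] with n hn
    by_contra hcon
    exact hn (X n) (hF n) hcon rfl
  obtain ⟨T, hT⟩ := eventually_atTop.1 hev
  -- The arrow of index `i` is consumed at a time at least `i`; hence arrows of index at least `T`
  -- are followed when the walk has already settled in `V`.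
  refine ⟨V, T, ⟨X T, hT T le_rfl⟩, fun z hz i hi => ?_⟩
  obtain ⟨n, hn, hn'⟩ := exists_visits_eq (Finset.mem_filter.1 hz).2 i
  have h1 : X (n + 1) = z + (ξ z i).1 := by
    rw [hX, walk_succ, ← hX, hn, hn']
  rw [← h1]
  refine hT _ ?_
  have := visits_le X z n
  omega

/-- If the range of the walk is finite with positive probability, then this is so without going
below the starting level. -/
lemma finiteRange_above_ne_zero {μ : Measure (Env d)} [IsProbabilityMeasure μ]
    (hIID : IsIID μ) (hEL : IsElliptic μ) (ℓ : Fin d → ℝ)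
    (h : stacksLaw μ {ξ | walk 0 ξ ∈ finiteRange d} ≠ 0) :
    stacksLaw μ {ξ | walk 0 ξ ∈ finiteRange d ∧ ∀ k, 0 ≤ dot (walk 0 ξ k) ℓ} ≠ 0 := by
  classical
  let E : Finset (Site d) × ℕ → Set (Stacks d) := fun q =>
    {ξ | q.1.Nonempty ∧ ∀ z ∈ q.1, ∀ i ≥ q.2, z + (ξ z i).1 ∈ q.1}
  obtain ⟨⟨V, k⟩, hq⟩ : ∃ q, stacksLaw μ (E q) ≠ 0 := by
    by_contra! hcon
    refine h (measure_mono_null (fun ξ hξ => ?_) (measure_iUnion_null hcon))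
    obtain ⟨V, k, hV⟩ := exists_trap hξ
    exact Set.mem_iUnion.2 ⟨(V, k), hV⟩
  -- One sample field supplies, at each site of `V`, an arrow that stays in `V`. Overwriting the
  -- first `k` arrows with it makes `V` a trap from the start, and starting at a lowest site `y` of
  -- `V` keeps the walk above its initial level.
  obtain ⟨ξ₀, hne, hξ₀⟩ := nonempty_of_measure_ne_zero hq
  obtain ⟨y, hy, hmin⟩ := V.exists_min_image (fun z => dot z ℓ) hne
  have hm : MeasurableSet {ξ : Stacks d | ∀ z ∈ V, ∀ i, z + (ξ z i).1 ∈ V} := by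
    have : {ξ : Stacks d | ∀ z ∈ V, ∀ i, z + (ξ z i).1 ∈ V} =
        ⋂ z ∈ V, ⋂ i, (fun ξ : Stacks d => ξ z i) ⁻¹' {e | z + e.1 ∈ V} := by ext; simp
    rw [this]
    exact .biInter V.countable_toSet fun z _ => .iInter fun i =>
      ((measurable_pi_apply i).comp (measurable_pi_apply z)) (Set.to_countable _).measurableSet
  have h1 : stacksLaw μ {ξ | ∀ z ∈ V, ∀ i, z + (ξ z i).1 ∈ V} ≠ 0 := by
    refine stacksLaw_ne_zero_of_overwrite hIID hEL (V ×ˢ Finset.range k) (fun z _ => ξ₀ z k) hm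
      ?_ hq
    rintro ξ ⟨-, hξ⟩ z hz i
    unfold overwrite
    split_ifs with hi
    · exact hξ₀ z hz k le_rfl
    · exact hξ z hz i (by simpa [hz] using hi)
  have h2 := stacksLaw_walk_sub μ y (measurableSet_inter_above measurableSet_finiteRange ℓ)
  simp only [Set.mem_ofPred_eq] at h2
  rw [← h2]
  refine fun h0 => h1 (measure_mono_null (fun ξ hξ => ?_) h0)
  have hstay : ∀ n, walk y ξ n ∈ V := by
    intro n
    induction n with
    | zero => exact hy
    | succ n ih =>
      rw [walk_succ]
      exact hξ _ ih _
  refine ⟨mem_finiteRange_iff.2 ⟨V.image fun z => z - y, fun n =>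
    Finset.mem_image_of_mem _ (hstay n)⟩, fun n => ?_⟩
  rw [dot_sub, sub_nonneg]
  exact hmin _ (hstay n)

end HalfSpace

/-! ### Mass transport and the recurrent graph -/

section MassTransport

variable {d : ℕ}

/-- The directed graph of the jumps prescribed infinitely often by the arrows `ξ`. -/
def edge (ξ : Stacks d) (z w : Site d) : Prop := ∃ᶠ i in atTop, z + (ξ z i).1 = w

/-- `w` can be reached from `z` in `n` steps of the graph `edge ξ`. -/
def reachIn (ξ : Stacks d) : ℕ → Site d → Site d → Prop
  | 0, z, w => z = w
  | n + 1, z, w => ∃ v, edge ξ z v ∧ reachIn ξ n v w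

/-- `w` can be reached from `z` in the graph `edge ξ`. -/
def reach (ξ : Stacks d) (z w : Site d) : Prop := ∃ n, reachIn ξ n z w

/-- `x` has maximal level among the sites reachable from `z`. -/
def isTop (ℓ : Fin d → ℝ) (ξ : Stacks d) (z x : Site d) : Prop :=
  reach ξ z x ∧ ∀ w, reach ξ z w → dot w ℓ ≤ dot x ℓ

/-- `x` is one of at most `K` sites of maximal level reachable from `z`. -/
def isTopAmong (ℓ : Fin d → ℝ) (K : ℕ) (ξ : Stacks d) (z x : Site d) : Prop :=
  isTop ℓ ξ z x ∧ ∃ F : Finset (Site d), F.card ≤ K ∧ ∀ w, isTop ℓ ξ z w → w ∈ F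

lemma measurableSet_edge (z w : Site d) : MeasurableSet {ξ : Stacks d | edge ξ z w} := by
  have : {ξ : Stacks d | edge ξ z w} =
      ⋂ N : ℕ, ⋃ i ≥ N, (fun ξ : Stacks d => ξ z i) ⁻¹' {e | z + e.1 = w} := by
    ext
    simp [edge, frequently_atTop]
  rw [this]
  exact .iInter fun N => .iUnion fun i => .iUnion fun _ =>
    ((measurable_pi_apply i).comp (measurable_pi_apply z)) (Set.to_countable _).measurableSet

lemma measurableSet_reach (z w : Site d) : MeasurableSet {ξ : Stacks d | reach ξ z w} := by
  have h : ∀ n z, MeasurableSet {ξ : Stacks d | reachIn ξ n z w} := by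
    intro n
    induction n with
    | zero => exact fun z => .const _
    | succ n ih =>
      intro z
      have : {ξ : Stacks d | reachIn ξ (n + 1) z w} =
          ⋃ v, {ξ : Stacks d | edge ξ z v} ∩ {ξ | reachIn ξ n v w} := by
        ext; simp [reachIn]
      rw [this]
      exact .iUnion fun v => (measurableSet_edge z v).inter (ih v)
  have : {ξ : Stacks d | reach ξ z w} = ⋃ n, {ξ | reachIn ξ n z w} := by ext; simp [reach]
  rw [this]
  exact .iUnion fun n => h n z

lemma measurableSet_isTop (ℓ : Fin d → ℝ) (z x : Site d) :
    MeasurableSet {ξ : Stacks d | isTop ℓ ξ z x} := by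
  have : {ξ : Stacks d | isTop ℓ ξ z x} =
      {ξ | reach ξ z x} ∩ ⋂ w, ({ξ | reach ξ z w}ᶜ ∪ {_ξ | dot w ℓ ≤ dot x ℓ}) := by
    ext; simp [isTop, imp_iff_not_or]
  rw [this]
  exact (measurableSet_reach z x).inter
    (.iInter fun w => (measurableSet_reach z w).compl.union (.const _))

lemma measurableSet_isTopAmong (ℓ : Fin d → ℝ) (K : ℕ) (z x : Site d) :
    MeasurableSet {ξ : Stacks d | isTopAmong ℓ K ξ z x} := by
  have : {ξ : Stacks d | isTopAmong ℓ K ξ z x} = {ξ | isTop ℓ ξ z x} ∩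
      ⋃ F : Finset (Site d), ({_ξ | F.card ≤ K} ∩
        ⋂ w, ({ξ | isTop ℓ ξ z w}ᶜ ∪ {_ξ | w ∈ F})) := by
    ext; simp [isTopAmong, imp_iff_not_or]
  rw [this]
  exact (measurableSet_isTop ℓ z x).inter (.iUnion fun F => (MeasurableSet.const _).inter
    (.iInter fun w => (measurableSet_isTop ℓ z w).compl.union (.const _)))

lemma edge_shiftStacks (a : Site d) (ξ : Stacks d) (z w : Site d) :
    edge (shiftStacks a ξ) z w ↔ edge ξ (z + a) (w + a) := by
  refine frequently_congr (.of_forall fun i => ?_)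
  rw [shiftStacks, add_right_comm, add_left_inj]

lemma reach_shiftStacks (a : Site d) (ξ : Stacks d) (z w : Site d) :
    reach (shiftStacks a ξ) z w ↔ reach ξ (z + a) (w + a) := by
  refine exists_congr fun n => ?_
  induction n generalizing z with
  | zero => simp [reachIn]
  | succ n ih =>
    simp only [reachIn, edge_shiftStacks, ih]
    exact (Equiv.addRight a).exists_congr_left.trans (by simp)

lemma isTop_shiftStacks (ℓ : Fin d → ℝ) (a : Site d) (ξ : Stacks d) (z x : Site d) :
    isTop ℓ (shiftStacks a ξ) z x ↔ isTop ℓ ξ (z + a) (x + a) := by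
  simp only [isTop, reach_shiftStacks]
  refine and_congr_right fun _ => ⟨fun h w hw => ?_, fun h w hw => ?_⟩
  · have := h (w - a) (by simpa using hw)
    rw [dot_sub] at this
    rw [dot_add]
    linarith
  · have := h (w + a) hw
    rw [dot_add, dot_add] at this
    linarith

lemma isTopAmong_shiftStacks (ℓ : Fin d → ℝ) (K : ℕ) (a : Site d) (ξ : Stacks d)
    (z x : Site d) :
    isTopAmong ℓ K (shiftStacks a ξ) z x ↔ isTopAmong ℓ K ξ (z + a) (x + a) := by
  classical
  simp only [isTopAmong, isTop_shiftStacks]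
  refine and_congr_right fun _ => ⟨?_, ?_⟩
  · rintro ⟨F, hF, h⟩
    refine ⟨F.image (· + a), Finset.card_image_le.trans hF, fun w hw => ?_⟩
    exact Finset.mem_image.2 ⟨w - a, h _ (by simpa using hw), by simp⟩
  · rintro ⟨F, hF, h⟩
    refine ⟨F.image (· - a), Finset.card_image_le.trans hF, fun w hw => ?_⟩
    exact Finset.mem_image.2 ⟨w + a, h _ hw, by simp⟩

/-- Mass transport: almost surely, every site is a top of the reachable sets, with boundedly many
tops, of finitely many sites only. -/
lemma ae_finite_isTopAmong (μ : Measure (Env d)) [IsProbabilityMeasure μ] (ℓ : Fin d → ℝ) :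
    ∀ᵐ ξ ∂stacksLaw μ, ∀ (K : ℕ) (x : Site d), {z | isTopAmong ℓ K ξ z x}.Finite := by
  refine ae_all_iff.2 fun K => ae_all_iff.2 fun x => ?_
  -- Each site sends unit mass to each of its tops, if there are at most `K` of them. The mass sent
  -- is at most `K`, so by translation invariance the expected mass received is at most `K`, and
  -- almost surely only finitely many sites contribute.
  let I : Site d → Site d → Stacks d → ENNReal := fun z y =>
    {ξ | isTopAmong ℓ K ξ z y}.indicator 1
  have hIm : ∀ z y, Measurable (I z y) := fun z y =>
    measurable_one.indicator (measurableSet_isTopAmong ℓ K z y)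
  have hIint : ∀ z y, ∫⁻ ξ, I z y ξ ∂stacksLaw μ = stacksLaw μ {ξ | isTopAmong ℓ K ξ z y} :=
    fun z y => lintegral_indicator_one (measurableSet_isTopAmong ℓ K z y)
  have hshift : ∀ z, stacksLaw μ {ξ | isTopAmong ℓ K ξ z x} =
      stacksLaw μ {ξ | isTopAmong ℓ K ξ 0 (x - z)} := by
    intro z
    rw [← stacksLaw_shift μ z (measurableSet_isTopAmong ℓ K 0 (x - z))]
    congr 1
    ext ξ
    simp [isTopAmong_shiftStacks]
  have hbound : ∀ ξ, ∑' y, I 0 y ξ ≤ K := by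
    intro ξ
    by_cases hex : ∃ y, isTopAmong ℓ K ξ 0 y
    · obtain ⟨-, -, F, hF, h⟩ := hex
      rw [tsum_eq_sum (s := F)]
      · calc ∑ y ∈ F, I 0 y ξ ≤ ∑ y ∈ F, 1 :=
              Finset.sum_le_sum fun y _ => Set.indicator_le_self' (by simp) ξ
          _ ≤ K := by simpa using hF
      · intro y hy
        exact Set.indicator_of_notMem (fun hy' => hy (h y hy'.1)) _
    · push Not at hex
      have : ∀ y, I 0 y ξ = 0 := fun y =>
        Set.indicator_of_notMem (s := {ξ | isTopAmong ℓ K ξ 0 y}) (hex y) _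
      simp [this]
  have hsum : ∫⁻ ξ, ∑' z, I z x ξ ∂stacksLaw μ ≤ K := by
    rw [lintegral_tsum fun z => (hIm z x).aemeasurable]
    simp only [hIint, hshift]
    refine ((Equiv.subLeft x).tsum_eq fun y =>
      stacksLaw μ {ξ | isTopAmong ℓ K ξ 0 y}).trans_le ?_
    simp only [← hIint]
    rw [← lintegral_tsum fun y => (hIm 0 y).aemeasurable]
    calc ∫⁻ ξ, ∑' y, I 0 y ξ ∂stacksLaw μ ≤ ∫⁻ _, K ∂stacksLaw μ := lintegral_mono hbound
      _ = K := by simp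
  have hlt := ae_lt_top (Measurable.tsum fun z => hIm z x)
    (ne_top_of_le_ne_top (ENNReal.natCast_ne_top K) hsum)
  filter_upwards [hlt] with ξ hξ
  refine (ENNReal.finite_const_le_of_tsum_ne_top hξ.ne one_ne_zero).subset fun z hz => ?_
  have : I z x ξ = 1 := Set.indicator_of_mem (s := {ξ | isTopAmong ℓ K ξ z x}) hz _
  exact this.ge

lemma exists_frequently_of_finite {α : Type*} {S : Set α} (hS : S.Finite) {p : ℕ → α → Prop}
    (h : ∃ᶠ n in atTop, ∃ a ∈ S, p n a) : ∃ a ∈ S, ∃ᶠ n in atTop, p n a := by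
  by_contra! hcon
  refine h ?_
  filter_upwards [(eventually_all_finite hS).2 hcon] with n hn
  push Not
  exact hn

/-- A walk with infinite range visiting finitely many sites above any level escapes downwards. -/
lemma escaping_neg_of_finite {ξ : Stacks d} {x : Site d} {ℓ : Fin d → ℝ}
    (hfin : ∀ u, ({z | u < dot z ℓ} ∩ Set.range (walk x ξ)).Finite)
    (hinf : walk x ξ ∉ finiteRange d)
    (hmt : ∀ (K : ℕ) (x : Site d), {z | isTopAmong ℓ K ξ z x}.Finite) :
    walk x ξ ∈ escaping (-ℓ) := by
  set X := walk x ξ with hX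
  by_contra hne
  obtain ⟨u, hu⟩ : ∃ u, ∃ᶠ n in atTop, u < dot (X n) ℓ := by
    by_contra! hcon
    refine hne ?_
    change Tendsto (fun n => dot (X n) (-ℓ)) atTop atTop
    simp only [dot_neg_right]
    exact tendsto_neg_atBot_atTop.comp
      (tendsto_atBot.2 fun b => by simpa [not_frequently] using hcon b)
  set V : Set (Site d) := {z | ∃ᶠ n in atTop, X n = z} with hV
  have hrange : ∀ z ∈ V, z ∈ Set.range X := fun z hz => by
    obtain ⟨n, hn⟩ := Frequently.exists hz
    exact ⟨n, hn⟩
  obtain ⟨z₀, hz₀, hz₀V⟩ : ∃ z₀ ∈ {z | u < dot z ℓ} ∩ Set.range X, z₀ ∈ V :=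
    exists_frequently_of_finite (p := fun n z => X n = z) (hfin u)
      (hu.mono fun n hn => ⟨X n, ⟨hn, n, rfl⟩, rfl⟩)
  have hVfin : (V ∩ {z | u < dot z ℓ}).Finite :=
    (hfin u).subset fun z hz => ⟨hz.2, hrange z hz.1⟩
  obtain ⟨t, ⟨htV, htu⟩, ht⟩ := Set.exists_max_image _ (fun z => dot z ℓ) hVfin
    ⟨z₀, hz₀V, hz₀.1⟩
  have hmax : ∀ w ∈ V, dot w ℓ ≤ dot t ℓ := by
    intro w hw
    by_cases hwu : u < dot w ℓ
    · exact ht w ⟨hw, hwu⟩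
    · exact (not_lt.1 hwu).trans (le_of_lt htu)
  -- A site visited infinitely often has its whole stack read, so every arrow occurring infinitely
  -- often there is followed infinitely often.
  have hclosed : ∀ z ∈ V, ∀ w, edge ξ z w → w ∈ V := by
    intro z hz w hw
    refine frequently_atTop.2 fun N => ?_
    obtain ⟨i, hi, hiw⟩ := frequently_atTop.1 hw N
    obtain ⟨n, hn, hn'⟩ := exists_visits_eq hz i
    refine ⟨n + 1, ?_, ?_⟩
    · have := visits_le X z n
      omega
    · rw [hX, walk_succ, ← hX, hn, hn', hiw]
  have hreach : ∀ z ∈ V, ∀ w, reach ξ z w → w ∈ V := by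
    rintro z hz w ⟨n, hn⟩
    induction n generalizing z with
    | zero =>
      have hn' : z = w := hn
      rwa [← hn']
    | succ n ih =>
      obtain ⟨v, hzv, hvw⟩ := hn
      exact ih v (hclosed z hz v hzv) hvw
  set K := hVfin.toFinset.card with hK
  set B : Set (Site d) := {z | z ∈ V ∧ reach ξ z t} with hB
  have hBfin : B.Finite := by
    -- For `z` in `B` the top level is that of `t`, so all tops of `z` lie in `V` above level `u`, a
    -- set of `K` sites.
    refine (hmt K t).subset ?_
    rintro z ⟨hzV, hzt⟩
    refine ⟨⟨hzt, fun w hw => hmax w (hreach z hzV w hw)⟩, hVfin.toFinset, le_rfl, ?_⟩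
    rintro w ⟨hzw, hw⟩
    rw [Set.Finite.mem_toFinset]
    exact ⟨hreach z hzV w hzw, lt_of_lt_of_le htu (hw t hzt)⟩
  have htB : t ∈ B := ⟨htV, 0, rfl⟩
  -- If the walk entered the finite set `B` from outside infinitely often, one fixed jump into `B`
  -- would recur. Its origin would be recurrent and joined by an edge to a site leading to `t`,
  -- hence already in `B`.
  have hback : ∀ᶠ n in atTop, X (n + 1) ∈ B → X n ∈ B := by
    by_contra hcon
    have hcon' : ∃ᶠ n in atTop, ∃ q ∈ B ×ˢ (Set.univ : Set (Dir d)),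
        X n ∉ B ∧ X n + q.2.1 = q.1 ∧ X (n + 1) = q.1 := by
      refine (not_eventually.1 hcon).mono fun n hn => ?_
      push Not at hn
      refine ⟨(X (n + 1), ξ (X n) (visits X (X n) n)), ⟨hn.1, trivial⟩, hn.2, ?_, rfl⟩
      rw [hX, walk_succ]
    obtain ⟨⟨z, e⟩, ⟨hz, -⟩, hfr⟩ := exists_frequently_of_finite
      (p := fun n (q : Site d × Dir d) => X n ∉ B ∧ X n + q.2.1 = q.1 ∧ X (n + 1) = q.1)
      (hBfin.prod Set.finite_univ) hcon'
    have hfr' : ∃ᶠ n in atTop, X n = z - e.1 ∧ X (n + 1) = z :=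
      hfr.mono fun n hn => ⟨eq_sub_of_add_eq hn.2.1, hn.2.2⟩
    have hwV : z - e.1 ∈ V := hfr'.mono fun n hn => hn.1
    have hedge : edge ξ (z - e.1) z := by
      refine frequently_atTop.2 fun N => ?_
      obtain ⟨n₀, -, hn₀⟩ := exists_visits_eq hwV N
      obtain ⟨n, hn, h1, h2⟩ := frequently_atTop.1 hfr' n₀
      refine ⟨visits X (z - e.1) n, hn₀.symm.le.trans (visits_mono X _ hn), ?_⟩
      have h3 : X (n + 1) = X n + (ξ (X n) (visits X (X n) n)).1 := by rw [hX, walk_succ]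
      rw [h1, h2] at h3
      exact h3.symm
    have hwB : z - e.1 ∈ B := by
      obtain ⟨m, hm⟩ := hz.2
      exact ⟨hwV, m + 1, z, hedge, hm⟩
    obtain ⟨n, hn⟩ := hfr.exists
    exact hn.1 (by rwa [eq_sub_of_add_eq hn.2.1])
  obtain ⟨T, hT⟩ := eventually_atTop.1 hback
  have hall : ∀ n ≥ T, X n ∈ B := by
    intro n hn
    -- Backward induction from a later visit to `t`.
    obtain ⟨m, hm, hmt⟩ := frequently_atTop.1 htV n
    refine Nat.decreasingInduction' (P := fun k => X k ∈ B) (fun k _ hk hk' => ?_) hm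
      (by rwa [hmt])
    exact hT k (hn.le.trans hk) hk'
  refine hinf (((Set.finite_Iio T).image X |>.union hBfin).subset ?_)
  rintro _ ⟨n, rfl⟩
  rcases lt_or_ge n T with h | h
  · exact Or.inl ⟨n, h, rfl⟩
  · exact Or.inr (hall n h)

/-- If the walk escapes in the direction `ℓ` with positive probability, then it almost surely
escapes in the direction `ℓ` or `-ℓ`. -/
lemma ae_escaping {μ : Measure (Env d)} [IsProbabilityMeasure μ]
    (hIID : IsIID μ) (hEL : IsElliptic μ) {ℓ : Fin d → ℝ} (hℓ : ℓ ≠ 0)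
    (h : stacksLaw μ {ξ | walk 0 ξ ∈ escaping ℓ} ≠ 0) :
    ∀ᵐ ξ ∂stacksLaw μ, walk 0 ξ ∈ escaping ℓ ∪ escaping (-ℓ) := by
  have h1 := ae_mem_of_not_bddAbove (μ := μ) ℓ (measurableSet_escaping ℓ) (fun X n a hX => by
    have hX' : Tendsto (fun k => dot (X (n + k) - a) ℓ) atTop atTop := hX
    simp only [dot_sub] at hX'
    change Tendsto (fun n => dot (X n) ℓ) atTop atTop
    rw [← tendsto_add_atTop_iff_nat n]
    simp only [add_comm _ n]
    have := tendsto_atTop_add_const_right atTop (dot a ℓ) hX'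
    simpa using this) (escaping_above_ne_zero hIID hEL hℓ h)
  have h2 : stacksLaw μ {ξ | walk 0 ξ ∈ finiteRange d} = 0 := by
    by_contra hne
    have h3 := ae_mem_of_not_bddAbove (μ := μ) ℓ measurableSet_finiteRange (fun X n a hX => by
      have hX' : (Set.range fun k => X (n + k) - a).Finite := hX
      refine (((Set.finite_Iio n).image X).union (hX'.image (· + a))).subset ?_
      rintro _ ⟨m, rfl⟩
      rcases lt_or_ge m n with hm | hm
      · exact Or.inl ⟨m, hm, rfl⟩
      · exact Or.inr ⟨_, ⟨m - n, rfl⟩, by simp [Nat.add_sub_cancel' hm]⟩)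
      (finiteRange_above_ne_zero hIID hEL ℓ hne)
    -- An escaping walk is unbounded above, so it would a.s. have finite range, which is impossible;
    -- escape would then be a null event.
    refine h (measure_mono_null (fun ξ hξ => ?_) (ae_iff.1 h3))
    have hξ' : Tendsto (fun n => dot (walk 0 ξ n) ℓ) atTop atTop := hξ
    have hb := not_bddAbove_of_tendsto_atTop hξ'
    refine fun hcon => hb ?_
    have hfin : (Set.range (walk 0 ξ)).Finite := hcon hb
    rw [← Function.comp_def (fun z => dot z ℓ) (walk 0 ξ), Set.range_comp]
    exact (hfin.image _).bddAbove
  have h2' : ∀ᵐ ξ ∂stacksLaw μ, walk 0 ξ ∉ finiteRange d := measure_eq_zero_iff_ae_notMem.1 h2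
  filter_upwards [h1, h2', ae_finite_of_bddAbove hIID hEL hℓ, ae_finite_isTopAmong μ ℓ]
    with ξ hξ1 hξ2 hξ3 hξ4
  by_cases hb : BddAbove (Set.range fun n => dot (walk 0 ξ n) ℓ)
  · exact Or.inr (escaping_neg_of_finite (hξ3 hb) hξ2 hξ4)
  · exact Or.inl (hξ1 hb)

/-- The level changes by at most a constant `C` in one step, so once its absolute value stays above
`C` its sign is fixed. -/
lemma tendsto_abs_dot_iff (x : Site d) (ξ : Stacks d) (ℓ : Fin d → ℝ) :
    Tendsto (fun n => |dot (walk x ξ n) ℓ|) atTop atTop ↔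
      walk x ξ ∈ escaping ℓ ∪ escaping (-ℓ) := by
  set f : ℕ → ℝ := fun n => dot (walk x ξ n) ℓ with hf
  have hneg : walk x ξ ∈ escaping (-ℓ) ↔ Tendsto (fun n => -f n) atTop atTop := by
    simp only [escaping, dot_neg_right, hf, Set.mem_ofPred_eq]
  have hpos : walk x ξ ∈ escaping ℓ ↔ Tendsto f atTop atTop := Iff.rfl
  rw [Set.mem_union, hneg, hpos]
  constructor
  · intro h
    obtain ⟨C, hC⟩ := (Set.finite_range fun e : Dir d => |dot e.1 ℓ|).bddAbove
    have hstep : ∀ n, |f (n + 1) - f n| ≤ C := by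
      intro n
      simp only [hf, walk_succ, dot_add, add_sub_cancel_left]
      exact hC ⟨_, rfl⟩
    obtain ⟨N, hN⟩ := eventually_atTop.1 (h.eventually (eventually_gt_atTop C))
    have hC0 : 0 ≤ C := (abs_nonneg _).trans (hstep 0)
    rcases lt_abs.1 (hN N le_rfl) with h0 | h0
    · left
      have hall : ∀ n ≥ N, C < f n := by
        intro n hn
        induction n, hn using Nat.le_induction with
        | base => exact h0
        | succ n hn ih =>
          rcases lt_abs.1 (hN (n + 1) (by omega)) with h1 | h1
          · exact h1
          · linarith [(abs_le.1 (hstep n)).1]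
      refine h.congr' ?_
      filter_upwards [eventually_ge_atTop N] with n hn
      exact abs_of_nonneg (hC0.trans (hall n hn).le)
    · right
      have hall : ∀ n ≥ N, C < -f n := by
        intro n hn
        induction n, hn using Nat.le_induction with
        | base => exact h0
        | succ n hn ih =>
          rcases lt_abs.1 (hN (n + 1) (by omega)) with h1 | h1
          · linarith [(abs_le.1 (hstep n)).2]
          · exact h1
      refine h.congr' ?_
      filter_upwards [eventually_ge_atTop N] with n hn
      exact abs_of_nonpos (by linarith [hall n hn])
  · rintro (h | h)
    · exact tendsto_abs_atTop_atTop.comp h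
    · simpa [Function.comp_def, hf] using tendsto_abs_atTop_atTop.comp h

end MassTransport

end ExcitedRW


/-! ### The zero-one law -/

open ExcitedRW
theorem mainTheorem4 {d : ℕ} (μ : Measure (Env d)) [IsProbabilityMeasure μ]
    (hIID : IsIID μ) (hEL : IsElliptic μ) (ℓ : Fin d → ℝ) (hℓ : ℓ ≠ 0) :
    annealedLaw μ 0 (absTransientEvent ℓ) =
        annealedLaw μ 0 (transientEvent ℓ ∪ transientEvent (-ℓ)) ∧
      (annealedLaw μ 0 (transientEvent ℓ ∪ transientEvent (-ℓ)) = 0 ∨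
        annealedLaw μ 0 (transientEvent ℓ ∪ transientEvent (-ℓ)) = 1) := by
  have hm := (measurableSet_escaping ℓ).union (measurableSet_escaping (-ℓ))
  have hunion : annealedLaw μ 0 (transientEvent ℓ ∪ transientEvent (-ℓ)) =
      stacksLaw μ {ξ | walk 0 ξ ∈ escaping ℓ ∪ escaping (-ℓ)} := annealedLaw_snd hIID 0 hm
  have habs : annealedLaw μ 0 (absTransientEvent ℓ) =
      stacksLaw μ {ξ | walk 0 ξ ∈ escaping ℓ ∪ escaping (-ℓ)} := by
    have hm' : MeasurableSet {X : Path d | Tendsto (fun n => |dot (X n) ℓ|) atTop atTop} :=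
      measurableSet_tendsto atTop fun n =>
        (measurable_of_countable fun z : Site d => |dot z ℓ|).comp (measurable_pi_apply n)
    refine (annealedLaw_snd hIID 0 hm').trans ?_
    congr 1
    ext ξ
    exact tendsto_abs_dot_iff 0 ξ ℓ
  rw [habs, hunion]
  refine ⟨rfl, or_iff_not_imp_left.2 fun hne => ?_⟩
  have hW : MeasurableSet {ξ : Stacks d | walk 0 ξ ∈ escaping ℓ ∪ escaping (-ℓ)} :=
    measurable_walk 0 hm
  rw [← mem_ae_iff_prob_eq_one hW]
  -- A union of positive probability has a part of positive probability; `ae_escaping` applies to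
  -- `ℓ` or to `-ℓ`.
  by_cases h : stacksLaw μ {ξ | walk 0 ξ ∈ escaping ℓ} = 0
  · have h' : stacksLaw μ {ξ | walk 0 ξ ∈ escaping (-ℓ)} ≠ 0 := fun h' =>
      hne (measure_union_null h h')
    have := ae_escaping hIID hEL (neg_ne_zero.2 hℓ) h'
    rw [neg_neg, Set.union_comm] at this
    exact this
  · exact ae_escaping hIID hEL hℓ h
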